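/- **Prolongation formula for $N=1$.** For $p\in\mathbb R$ put $\langle p\rangle=\lfloor p\rfloor$ if $p\ge 0$ and $\langle p\rangle=-1$ if $p<0$, let $$D^p_{a,x}f(x)=\frac{1}{\Gamma(1+\langle p\rangle-p)}\frac{d^{\langle p\rangle+1}}{dx^{\langle p\rangle+1}}\int_a^x (x-\tau)^{\langle p\rangle-p}f(\tau)\,d\tau$$ be the Riemann–Liouville operator, and let $\binom pk=\frac{p(p-1)\cdots(p-k+1)}{k!}$ and $c_k(x)=\binom pk\frac{(x-a)^{k-p}}{\Gamma(k-p+1)}$, where $1/\Gamma=0$ at the poles of $\Gamma$. On the infinite jet space with coordinates $(x,u_0,u_1,\dots)$, $u_0=u$, let $D=\partial_x+\sum_{k\ge0}u_{k+1}\partial_{u_k}$ be the total derivative. The operator $D^p_{a,x}u$ is regarded as the function $\sum_{k\ge0}c_k(x)u_k$ on the jet space, and the fractional total derivative of a function $G$ on the jet space is $\sum_{k\ge 0}c_k(x)D^kG$. The infinite prolongation of $\mathbf v=\xi(x,u)\partial_x+\phi(x,u)\partial_u$ is $$\mathrm{pr}^\infty\mathbf v=\xi\,\partial_x+\sum_{k\ge0}\phi^k\partial_{u_k},\qquad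 \phi^k=D^k(\phi-\xi u_1)+\xi u_{k+1}\quad(\phi^0=\phi),$$ and $\phi^p:=\mathrm{pr}^\infty\mathbf v\,[D^p_{a,x}u]$. Let $a<b$ and $p$ be real, let $M\subseteq\mathbb R^2$, let $\xi,\phi$ be real analytic at every point of $M$ with $\xi(a,v)=0$ whenever $(a,v)\in M$, and let $u$ be real analytic on $(a,b)$ with $(y,u(y))\in M$ for all $y\in[a,b)$. For $x>a$ say that $f$ *has long Taylor radius at $x$* if there are $c>x$ and a power series centred at $x$ that converges on an open interval around $x$ of half-length greater than $x-a$ and whose sum is $f$ at the points of $[a,c)$ in that interval. **(1)** Let $x\in(a,b)$ be such that $u$, $y\mapsto\xi(y,u(y))$ and $y\mapsto\phi(y,u(y))$ have long Taylor radius at $x$. Then, at the jet of $u$ at $x$, the series $\sum_k c_k u_k$ converges to the Riemann–Liouville derivative $D^p_{a,x}u(x)$, the fractional total derivative of $\phi$ converges and equals $D^p_{a,x}[\phi(x,u(x))]$, all derivatives and series that define $\phi^p$ exist, and $$\phi^p=D^p_{a,x}\phi-\sum_{n=0}^\infty\binom p{n+1}\frac{d^{n+1}\xi}{dx^{n+1}}\,D^{p-n}_{a,x}u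 ,$$ where the series converges absolutely, and $D^p_{a,x}\phi$ and $d^{n+1}\xi/dx^{n+1}$ are taken of the composite functions $\phi(x,u(x))$ and $\xi(x,u(x))$. **(2)** Suppose moreover that $a=0$, $p>0$, and that, with the number $U=u(x)$ held fixed, $y\mapsto\phi(y,U)$ and $y\mapsto\partial_u\phi(y,U)$ have long Taylor radius at $x$. Write $\bar D^p_{0,x}\phi$ and $\bar D^p_{0,x}\partial_u\phi$ for $D^p_{0,x}$ applied at $x$ to these two functions, in which $u$ is held fixed. Then Osler's formula $$D^p_{0,x}\phi(x,u(x))=\sum_{n=0}^\infty\sum_{m=0}^n\sum_{k=0}^m\sum_{r=0}^k\binom pn\binom nm\binom kr\frac{x^{n-p}(-u)^r}{k!\,\Gamma(n+1-p)}\frac{d^m u^{k-r}}{dx^m}\frac{\partial^{n-m+k}\phi}{\partial x^{n-m}\partial u^k}$$ holds, and, with $$\mu^p=\sum_{n=2}^\infty\sum_{m=2}^n\sum_{k=2}^m\sum_{r=0}^{k-1}\binom pn\binom nm\binom kr\frac{x^{n-p}(-u)^r}{k!\,\Gamma(n+1-p)}\frac{d^m u^{k-r}}{dx^m}\frac{\partial^{n-m+k}\phi}{\partial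 x^{n-m}\partial u^k},$$ one has $$D^p_{0,x}\phi(x,u(x))=\bar D^p_{0,x}\phi-u\,\bar D^p_{0,x}(\partial_u\phi)+\partial_u\phi\,D^p_{0,x}u+\sum_{k=1}^\infty\binom pk\frac{\partial^{k+1}\phi}{\partial x^k\partial u}D^{p-k}_{0,x}u+\mu^p$$ and $$\phi^p=\bar D^p_{0,x}\phi+D^p_{0,x}u\Bigl(\partial_u\phi-p\frac{d\xi}{dx}\Bigr)-u\,\bar D^p_{0,x}\partial_u\phi+\mu^p+\sum_{n=1}^\infty\Bigl[\binom pn\partial_x^n\partial_u\phi-\binom p{n+1}\frac{d^{n+1}\xi}{dx^{n+1}}\Bigr]D^{p-n}_{0,x}u ,$$ all outer series (over $n$ or $k$) being absolutely convergent. **(3)** If $u$ is also real analytic at $a$, then the assumptions on Taylor radii in (1), and those in (2) read with $a$ in place of $0$, hold for all $x>a$ sufficiently close to $a$. -/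

import Mathlib

open Filter Topology Set

noncomputable section

/-- The symbol `⟪p⟫`: the floor of `p` if `p ≥ 0`, and `-1` if `p < 0`. -/
def media (p : ℝ) : ℤ := if 0 ≤ p then ⌊p⌋ else -1

/-- The Riemann--Liouville operator of order `p` with terminals `(a, t)`. -/
def RL (a p : ℝ) (f : ℝ → ℝ) (t : ℝ) : ℝ :=
  1 / Real.Gamma (1 + (media p : ℝ) - p) *
    iteratedDeriv (media p + 1).toNat
      (fun s => ∫ τ in a..s, (s - τ) ^ ((media p : ℝ) - p) * f τ) t

/-- Generalized binomial coefficient `p (p - 1) ⋯ (p - k + 1) / k!`. -/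
def binom (p : ℝ) (k : ℕ) : ℝ := (∏ i ∈ Finset.range k, (p - i)) / (k.factorial : ℝ)

/-- `binom(p, k) (x - a)^{k - p} / Γ(k - p + 1)`. At a pole of `Γ` the value is `0`, as it should
be, since Mathlib has `Γ = 0` and `1 / 0 = 0` there. -/
def rlCoeff (a p : ℝ) (k : ℕ) (x : ℝ) : ℝ :=
  binom p k * ((x - a) ^ ((k : ℝ) - p) / Real.Gamma ((k : ℝ) - p + 1))

/-- The infinite jet space for one independent and one dependent variable, in the coordinates
`(x, (u₀, u₁, u₂, …))` where `u₀ = u` and `u_k` stands for the `k`-th derivative of `u`. -/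
abbrev Jet : Type := ℝ × (ℕ → ℝ)

/-- The infinite jet of `u` at `x`. -/
def jetOf (u : ℝ → ℝ) (x : ℝ) : Jet := (x, fun k => iteratedDeriv k u x)

/-- `∂/∂x` on functions on the jet space. -/
def jetDx (G : Jet → ℝ) (z : Jet) : ℝ := deriv (fun s => G (s, z.2)) z.1

/-- `∂/∂u_k` on functions on the jet space. -/
def jetDu (k : ℕ) (G : Jet → ℝ) (z : Jet) : ℝ :=
  deriv (fun s => G (z.1, Function.update z.2 k s)) (z.2 k)

/-- The total derivative `D = ∂/∂x + ∑_k u_{k+1} ∂/∂u_k`. It is only applied to functions of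
finitely many jet coordinates, for which the sum is finite. -/
def totalDeriv (G : Jet → ℝ) (z : Jet) : ℝ :=
  jetDx G z + ∑ᶠ k : ℕ, z.2 (k + 1) * jetDu k G z

/-- A function of `(x, u)` as a function on the jet space. -/
def onJet (g : ℝ × ℝ → ℝ) (z : Jet) : ℝ := g (z.1, z.2 0)

/-- The fractional total derivative
`∑_k binom(p, k) (x - a)^{k - p} / Γ(k - p + 1) D^k G`. -/
def fracTotalDeriv (a p : ℝ) (G : Jet → ℝ) (z : Jet) : ℝ :=
  ∑' k : ℕ, rlCoeff a p k z.1 * (totalDeriv^[k] G) z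

/-- The Riemann--Liouville derivative of `u` as a function on the jet space:
`∑_k binom(p, k) (x - a)^{k - p} / Γ(k - p + 1) u_k`. -/
def rlJet (a p : ℝ) (z : Jet) : ℝ := ∑' k : ℕ, rlCoeff a p k z.1 * z.2 k

/-- The coefficient of `∂/∂u_k` in the infinite prolongation of `ξ ∂_x + φ ∂_u`:
`D^k (φ - ξ u₁) + ξ u_{k+1}`. For `k = 0` it is `φ`. -/
def prolongCoeff (ξ φ : ℝ × ℝ → ℝ) (k : ℕ) (z : Jet) : ℝ :=
  (totalDeriv^[k] (fun w => onJet φ w - onJet ξ w * w.2 1)) z + onJet ξ z * z.2 (k + 1)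

/-- All the derivatives and the series occurring in `prolong ξ φ G z` exist. -/
def ProlongDefined (ξ φ : ℝ × ℝ → ℝ) (G : Jet → ℝ) (z : Jet) : Prop :=
  DifferentiableAt ℝ (fun s => G (s, z.2)) z.1 ∧
  (∀ k : ℕ, DifferentiableAt ℝ (fun s => G (z.1, Function.update z.2 k s)) (z.2 k)) ∧
  Summable (fun k : ℕ => prolongCoeff ξ φ k z * jetDu k G z)

/-- The infinite prolongation of `ξ ∂_x + φ ∂_u` applied to a function `G` on the jet space. -/
def prolong (ξ φ : ℝ × ℝ → ℝ) (G : Jet → ℝ) (z : Jet) : ℝ :=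
  onJet ξ z * jetDx G z + ∑' k : ℕ, prolongCoeff ξ φ k z * jetDu k G z

/-- `∂^{i+j} g / ∂x^i ∂u^j` at the point `(x, v)`. -/
def pderiv (i j : ℕ) (g : ℝ × ℝ → ℝ) (x v : ℝ) : ℝ :=
  iteratedDeriv i (fun y => iteratedDeriv j (fun w => g (y, w)) v) x

/-- On `[a, x]` and to the right of `x` near `x`, the function `f` is the sum of a power series
centred at `x` whose radius of convergence exceeds `x - a`. -/
def TaylorReaches (a x : ℝ) (f : ℝ → ℝ) : Prop :=
  ∃ c > x, ∃ (q : FormalMultilinearSeries ℝ ℝ ℝ) (r : ENNReal),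
    ENNReal.ofReal (x - a) < r ∧ HasFPowerSeriesWithinOnBall f q (Ico a c) x r

/-- The summand with indices `n, m, k, r` in Osler's chain rule for `g (x, u x)`,
with lower terminal `0`. -/
def oslerTerm (p : ℝ) (g : ℝ × ℝ → ℝ) (u : ℝ → ℝ) (x : ℝ) (n m k r : ℕ) : ℝ :=
  binom p n * (n.choose m : ℝ) * (k.choose r : ℝ) *
    (x ^ ((n : ℝ) - p) * (-u x) ^ r / ((k.factorial : ℝ) * Real.Gamma ((n : ℝ) + 1 - p))) *
    iteratedDeriv m (fun y => u y ^ (k - r)) x * pderiv (n - m) k g x (u x)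

/-- The `n`-th term of the series `μ^p`; it vanishes for `n < 2`. -/
def muTerm (p : ℝ) (φ : ℝ × ℝ → ℝ) (u : ℝ → ℝ) (x : ℝ) (n : ℕ) : ℝ :=
  ∑ m ∈ Finset.Icc 2 n, ∑ k ∈ Finset.Icc 2 m, ∑ r ∈ Finset.range k, oslerTerm p φ u x n m k r

/-- The remainder `μ^p`. -/
def mu (p : ℝ) (φ : ℝ × ℝ → ℝ) (u : ℝ → ℝ) (x : ℝ) : ℝ := ∑' n : ℕ, muTerm p φ u x n

end

/-!
The formulas rest on one fact, `hasSum_RL`: on functions whose Taylor series at `x` converges beyond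
distance `x - a`, the Riemann--Liouville operator is the series `∑_k c_k(x) f^{(k)}(x)` with
coefficients `rlCoeff`. For a negative order this is termwise integration of the Taylor series
against the kernel. A nonnegative order is reached by differentiating the series for `p - m < 0`
termwise `m` times: Pascal's rule (`rlCoeff_add_one_succ`) says that `c_k' + c_{k-1}` is the `k`-th
coefficient of order one higher, so each derivative raises the order by one (`hasDerivAt_rlSeries`).
Domination comes from two bounds: `k! |c_k(x)|` is at most a constant times `(x - a)^k`, while the
`k`-th derivatives near `x` are at most `C k! / ρ^k` with `ρ > x - a` (`TaylorGrowth`).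

With these bounds all series converge absolutely and double series may be rearranged. Because
`binom(p, n) c^{p-n}_k = binom(n + k, n) c^p_{n+k}`, the ordinary Leibniz rule for `(f g)^{(m)}`,
summed against `c^p_m`, turns into the fractional Leibniz rule
`∑_n binom(p, n) f^{(n)} D^{p-n} g` (`TaylorGrowth.hasSum_leibniz`).

On the jet of `u`, total derivatives are derivatives along the graph, so `φ^k` is
`φ^{(k)} - (ξ u')^{(k)} + ξ u^{(k+1)}` for the composite functions. Summing against `c_k` and
applying the Leibniz rule to `ξ u'` gives the prolongation formula up to boundary terms, which come
from `D^q u' = D^{q+1} u - u(a) (x - a)^{-q-1} / Γ(-q)`. These boundary terms add up to a multiple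
of the Taylor series of `ξ` from `x` to `a`, that is, of `ξ(a, u(a)) = 0` (`leibniz_deriv`).

Osler's formula is the same series applied to `φ(x, u(x))`, with its `n`-th derivative written out
by the chain rule `iteratedDeriv_graph`, which expands `φ` in powers of `u - u(x)`. The terms of
degree zero and one of that expansion are separated off by the Leibniz rule for `u ∂_uφ(·, u(x))`
(`RL_graph_eq`), and what remains is `μ^p`.
-/

/-! ### The coefficients of the series of the Riemann--Liouville operator -/

/-- The derivative of `rlCoeff a p k` at `x > a`. -/
noncomputable def rlCoeffDeriv (a p : ℝ) (k : ℕ) (x : ℝ) : ℝ :=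
  binom p k * ((x - a) ^ ((k : ℝ) - p - 1) / Real.Gamma ((k : ℝ) - p))

theorem binom_zero (p : ℝ) : binom p 0 = 1 := by simp [binom]

theorem binom_one (p : ℝ) : binom p 1 = p := by simp [binom]

theorem binom_succ (p : ℝ) (k : ℕ) : binom p (k + 1) = binom p k * ((p - k) / (k + 1)) := by
  have hk : (k.factorial : ℝ) ≠ 0 := by positivity
  have hk' : (k : ℝ) + 1 ≠ 0 := by positivity
  simp only [binom, Finset.prod_range_succ, Nat.factorial_succ]
  push_cast
  field_simp

theorem binom_add_one_succ (p : ℝ) (k : ℕ) :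
    binom (p + 1) (k + 1) = binom p (k + 1) + binom p k := by
  have hk : (k.factorial : ℝ) ≠ 0 := by positivity
  have hk' : (k : ℝ) + 1 ≠ 0 := by positivity
  have h : ∏ i ∈ Finset.range (k + 1), (p + 1 - i) =
      (p + 1) * ∏ i ∈ Finset.range k, (p - i) := by
    rw [Finset.prod_range_succ', mul_comm]
    push_cast
    simp
  rw [binom_succ p]
  simp only [binom, h, Nat.factorial_succ]
  push_cast
  field_simp
  ring

theorem binom_mul_binom_sub (p : ℝ) (n k : ℕ) :
    binom p n * binom (p - n) k = ((n + k).choose n : ℝ) * binom p (n + k) := by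
  have hn : (n.factorial : ℝ) ≠ 0 := by positivity
  have hk : (k.factorial : ℝ) ≠ 0 := by positivity
  have hnk : ((n + k).factorial : ℝ) ≠ 0 := by positivity
  rw [Nat.cast_choose ℝ (Nat.le_add_right n k), Nat.add_sub_cancel_left]
  simp only [binom, Finset.prod_range_add]
  have : ∀ i : ℕ, p - (((n + i : ℕ)) : ℝ) = p - n - i := fun i => by push_cast; ring
  simp only [this]
  field_simp

/-- The relation between coefficients of orders `p - n` and `p` behind the fractional Leibniz
rule. -/
theorem binom_mul_rlCoeff_sub (a p x : ℝ) (n k : ℕ) :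
    binom p n * rlCoeff a (p - n) k x = ((n + k).choose n : ℝ) * rlCoeff a p (n + k) x := by
  unfold rlCoeff
  rw [← mul_assoc, binom_mul_binom_sub, mul_assoc]
  congr 4 <;> push_cast <;> ring_nf

theorem rlCoeff_add_one_zero (a p x : ℝ) : rlCoeff a (p + 1) 0 x = rlCoeffDeriv a p 0 x := by
  simp only [rlCoeff, rlCoeffDeriv, binom_zero]
  congr 3 <;> push_cast <;> ring_nf

/-- Pascal's rule for the coefficients, which makes differentiation raise the order by one. -/
theorem rlCoeff_add_one_succ (a p x : ℝ) (k : ℕ) :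
    rlCoeff a (p + 1) (k + 1) x = rlCoeffDeriv a p (k + 1) x + rlCoeff a p k x := by
  simp only [rlCoeff, rlCoeffDeriv, binom_add_one_succ, add_mul]
  push_cast
  congr 4 <;> ring_nf

theorem hasDerivAt_rlCoeff {a x : ℝ} (hax : a < x) (p : ℝ) (k : ℕ) :
    HasDerivAt (rlCoeff a p k) (rlCoeffDeriv a p k x) x := by
  have h1 : HasDerivAt (fun t : ℝ => (t - a) ^ ((k : ℝ) - p))
      (((k : ℝ) - p) * (x - a) ^ ((k : ℝ) - p - 1)) x := by
    have := ((hasDerivAt_id x).sub_const a).rpow_const (p := (k : ℝ) - p)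
      (Or.inl (sub_pos.2 hax).ne')
    simpa using this
  have h2 := (h1.div_const (Real.Gamma ((k : ℝ) - p + 1))).const_mul (binom p k)
  refine h2.congr_deriv ?_
  unfold rlCoeffDeriv
  rcases eq_or_ne ((k : ℝ) - p) 0 with h | h
  · simp [h]
  · rw [Real.Gamma_add_one h, mul_div_mul_left _ _ h]

/-- At a natural number `p` both sides vanish for every `k`, by the convention `1 / Γ = 0` at the
poles of `Γ`. -/
theorem binom_div_Gamma (p : ℝ) (k : ℕ) :
    binom p k / Real.Gamma ((k : ℝ) - p) =
      (-1) ^ k / ((k.factorial : ℝ) * Real.Gamma (-p)) := by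
  induction k with
  | zero => simp [binom_zero]
  | succ k ih =>
    rcases eq_or_ne ((k : ℝ) - p) 0 with h | h
    · obtain rfl : p = k := by linarith
      simp [binom_succ, Real.Gamma_neg_nat_eq_zero]
    · have hk' : (k : ℝ) + 1 ≠ 0 := by positivity
      have e : ((k + 1 : ℕ) : ℝ) - p = (k : ℝ) - p + 1 := by push_cast; ring
      have e2 : (p - k) / ((k : ℝ) - p) = -1 := by
        rw [div_eq_iff h]; ring
      rw [e, Real.Gamma_add_one h, binom_succ, Nat.factorial_succ]
      calc _ = binom p k / Real.Gamma ((k : ℝ) - p) * ((p - k) / ((k : ℝ) - p)) / (k + 1) := by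
            simp only [div_eq_mul_inv, mul_inv]; ring
        _ = _ := by
            rw [ih, e2]
            push_cast
            simp only [div_eq_mul_inv, mul_inv]
            ring

/-- The `k`-th coefficient of the differentiated series is, up to a common factor, the coefficient
of the `k`-th derivative in the Taylor series from `x` to `a`. -/
theorem rlCoeffDeriv_eq {a x : ℝ} (hax : a < x) (p : ℝ) (k : ℕ) :
    rlCoeffDeriv a p k x =
      (x - a) ^ (-p - 1) / Real.Gamma (-p) * ((a - x) ^ k / (k.factorial : ℝ)) := by
  have h : (x - a) ^ ((k : ℝ) - p - 1) = (x - a) ^ (-p - 1) * (x - a) ^ k := by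
    rw [← Real.rpow_natCast, ← Real.rpow_add (sub_pos.2 hax)]
    ring_nf
  have e : a - x = -1 * (x - a) := by ring
  calc _ = binom p k / Real.Gamma ((k : ℝ) - p) * (x - a) ^ ((k : ℝ) - p - 1) := by
        unfold rlCoeffDeriv; ring
    _ = _ := by
        rw [binom_div_Gamma, h, e, mul_pow]
        simp only [div_eq_mul_inv, mul_inv]
        ring

/-- The bound `k! |binom(p, k)| / |Γ(k - p + 1)| ≤ K`: for large `k` the left-hand side is
`1 / (|Γ(-p)| (k - p))`. -/
theorem exists_abs_binom_div_Gamma_le (p : ℝ) :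
    ∃ K, 0 ≤ K ∧ ∀ k : ℕ,
      |binom p k / Real.Gamma ((k : ℝ) - p + 1)| * (k.factorial : ℝ) ≤ K := by
  set g : ℕ → ℝ := fun k => |binom p k / Real.Gamma ((k : ℝ) - p + 1)| * (k.factorial : ℝ) with hg
  have hg0 : ∀ k, 0 ≤ g k := fun k => by positivity
  refine ⟨∑ i ∈ Finset.range (⌈p⌉₊ + 1), g i + |Real.Gamma (-p)|⁻¹, by positivity, fun k => ?_⟩
  change g k ≤ _
  have hS : 0 ≤ ∑ i ∈ Finset.range (⌈p⌉₊ + 1), g i := Finset.sum_nonneg fun i _ => hg0 i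
  rcases lt_or_ge k (⌈p⌉₊ + 1) with h | h
  · have := Finset.single_le_sum (fun i _ => hg0 i) (Finset.mem_range.2 h)
    have h2 : 0 ≤ |Real.Gamma (-p)|⁻¹ := by positivity
    linarith
  · have h1 : p + 1 ≤ k := by
      have h2 := Nat.le_ceil p
      have h3 : ((⌈p⌉₊ + 1 : ℕ) : ℝ) ≤ k := by exact_mod_cast h
      push_cast at h3
      linarith
    have h0 : (k : ℝ) - p ≠ 0 := by linarith
    have hf : (k.factorial : ℝ) ≠ 0 := by positivity
    have : g k = |Real.Gamma (-p)|⁻¹ * ((k : ℝ) - p)⁻¹ := by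
      have e : binom p k / Real.Gamma ((k : ℝ) - p + 1) =
          binom p k / Real.Gamma ((k : ℝ) - p) * ((k : ℝ) - p)⁻¹ := by
        rw [Real.Gamma_add_one h0]
        simp only [div_eq_mul_inv, mul_inv]
        ring
      have h5 : |((k : ℝ) - p)⁻¹| = ((k : ℝ) - p)⁻¹ :=
        abs_of_pos (inv_pos.2 (by linarith))
      simp only [hg]
      rw [e, binom_div_Gamma, abs_mul, h5, abs_div, abs_mul, abs_pow, abs_neg, abs_one, one_pow,
        Nat.abs_cast]
      field_simp
    rw [this]
    have h4 : ((k : ℝ) - p)⁻¹ ≤ 1 := inv_le_one_of_one_le₀ (by linarith)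
    have h5 := mul_le_mul_of_nonneg_left h4 (inv_nonneg.2 (abs_nonneg (Real.Gamma (-p))))
    linarith

theorem exists_abs_rlCoeff_le (p : ℝ) :
    ∃ K, 0 ≤ K ∧ ∀ (a x : ℝ), a < x → ∀ k : ℕ,
      |rlCoeff a p k x| ≤ K * (x - a) ^ (-p) * ((x - a) ^ k / (k.factorial : ℝ)) := by
  obtain ⟨K, hK0, hK⟩ := exists_abs_binom_div_Gamma_le p
  refine ⟨K, hK0, fun a x hax k => ?_⟩
  have hx := sub_pos.2 hax
  have h : (x - a) ^ ((k : ℝ) - p) = (x - a) ^ (-p) * (x - a) ^ k := by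
    rw [← Real.rpow_natCast, ← Real.rpow_add hx]
    ring_nf
  have hf : (0 : ℝ) < (k.factorial : ℝ) := by positivity
  have e : rlCoeff a p k x = binom p k / Real.Gamma ((k : ℝ) - p + 1) * (x - a) ^ ((k : ℝ) - p) := by
    unfold rlCoeff; ring
  have h0 : 0 ≤ (x - a) ^ (-p) * (x - a) ^ k := by positivity
  rw [e, h, abs_mul, abs_of_nonneg h0]
  calc _ ≤ K / (k.factorial : ℝ) * ((x - a) ^ (-p) * (x - a) ^ k) :=
        mul_le_mul_of_nonneg_right ((le_div_iff₀ hf).2 (hK k)) h0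
    _ = _ := by ring

theorem abs_rlCoeffDeriv {a x : ℝ} (hax : a < x) (p : ℝ) (k : ℕ) :
    |rlCoeffDeriv a p k x| =
      |Real.Gamma (-p)|⁻¹ * (x - a) ^ (-p - 1) * ((x - a) ^ k / (k.factorial : ℝ)) := by
  have hx := sub_pos.2 hax
  have h0 : 0 < (x - a) ^ (-p - 1) := Real.rpow_pos_of_pos hx _
  rw [rlCoeffDeriv_eq hax, abs_mul, abs_div, abs_div, abs_pow, abs_of_pos h0, Nat.abs_cast,
    abs_sub_comm, abs_of_pos hx]
  ring

/-! ### Sequences growing like the derivatives of an analytic function -/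

/-- `A k` grows at most like the `k`-th derivatives at a point of a function whose Taylor series
there has radius of convergence greater than `R`. -/
def TaylorGrowth (R : ℝ) (A : ℕ → ℝ) : Prop :=
  ∃ C ρ : ℝ, R < ρ ∧ ∀ k : ℕ, |A k| ≤ C * (k.factorial : ℝ) / ρ ^ k

namespace TaylorGrowth

variable {R : ℝ} {A B : ℕ → ℝ}

theorem mono (hB : TaylorGrowth R B) (h : ∀ k, |A k| ≤ |B k|) : TaylorGrowth R A := by
  obtain ⟨C, ρ, hρ, hC⟩ := hB
  exact ⟨C, ρ, hρ, fun k => (h k).trans (hC k)⟩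

theorem exists_gt (hA : TaylorGrowth R A) : ∃ R' > R, TaylorGrowth R' A := by
  obtain ⟨C, ρ, hρ, hC⟩ := hA
  obtain ⟨R', h1, h2⟩ := exists_between hρ
  exact ⟨R', h1, C, ρ, h2, hC⟩

theorem summable (hR : 0 ≤ R) (hA : TaylorGrowth R A) :
    Summable fun k => |A k| * (R ^ k / (k.factorial : ℝ)) := by
  obtain ⟨C, ρ, hρ, hC⟩ := hA
  have hρ0 : 0 < ρ := hR.trans_lt hρ
  have hg : Summable fun k : ℕ => C * (R / ρ) ^ k :=
    (summable_geometric_of_lt_one (by positivity) ((div_lt_one hρ0).2 hρ)).mul_left C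
  refine hg.of_nonneg_of_le (fun k => by positivity) fun k => ?_
  have hf : (0 : ℝ) < (k.factorial : ℝ) := by positivity
  calc _ ≤ C * (k.factorial : ℝ) / ρ ^ k * (R ^ k / (k.factorial : ℝ)) :=
        mul_le_mul_of_nonneg_right (hC k) (by positivity)
    _ = _ := by rw [div_pow]; field_simp

theorem shift (hR : 0 ≤ R) (hA : TaylorGrowth R A) : TaylorGrowth R fun k => A (k + 1) := by
  obtain ⟨C, ρ, hρ, hC⟩ := hA
  have hρ0 : 0 < ρ := hR.trans_lt hρ
  obtain ⟨σ, h1, h2⟩ := exists_between hρ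
  have hσ0 : 0 < σ := hR.trans_lt h1
  have hθ : σ / ρ < 1 := (div_lt_one hρ0).2 h2
  have hθ0 : 0 ≤ σ / ρ := by positivity
  have hC0 : 0 ≤ C := by simpa using (abs_nonneg _).trans (hC 0)
  -- `(k + 1) (σ / ρ) ^ k` is bounded, so the factor `k + 1` costs a smaller radius only
  have hs : Summable fun k : ℕ => (k : ℝ) * (σ / ρ) ^ k := by
    simpa using summable_pow_mul_geometric_of_norm_lt_one 1 (r := σ / ρ)
      (by rwa [Real.norm_of_nonneg hθ0])
  have hb : ∀ k : ℕ, ((k : ℝ) + 1) * (σ / ρ) ^ k ≤ ∑' k : ℕ, (k : ℝ) * (σ / ρ) ^ k + 1 := by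
    intro k
    have := hs.le_tsum k fun j _ => by positivity
    have h3 : (σ / ρ) ^ k ≤ 1 := pow_le_one₀ hθ0 hθ.le
    linarith
  refine ⟨C / ρ * (∑' k : ℕ, (k : ℝ) * (σ / ρ) ^ k + 1), σ, h1, fun k => (hC (k + 1)).trans ?_⟩
  have e : C * ((k + 1).factorial : ℝ) / ρ ^ (k + 1) =
      C / ρ * (((k : ℝ) + 1) * (σ / ρ) ^ k) * (k.factorial : ℝ) / σ ^ k := by
    rw [Nat.factorial_succ, div_pow, pow_succ]
    push_cast
    field_simp
  rw [e]
  gcongr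
  exact hb k

theorem abs_add (hA : TaylorGrowth R A) (hB : TaylorGrowth R B) (hR : 0 ≤ R) :
    TaylorGrowth R fun k => |A k| + |B k| := by
  obtain ⟨C, ρ, hρ, hC⟩ := hA
  obtain ⟨D, σ, hσ, hD⟩ := hB
  have hC0 : 0 ≤ C := by simpa using (abs_nonneg _).trans (hC 0)
  have hD0 : 0 ≤ D := by simpa using (abs_nonneg _).trans (hD 0)
  have hm : 0 < min ρ σ := lt_min (hR.trans_lt hρ) (hR.trans_lt hσ)
  refine ⟨C + D, min ρ σ, lt_min hρ hσ, fun k => ?_⟩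
  rw [abs_of_nonneg (by positivity), add_mul, add_div]
  refine add_le_add ?_ ?_
  · refine (hC k).trans ?_
    gcongr
    exact min_le_left _ _
  · refine (hD k).trans ?_
    gcongr
    exact min_le_right _ _

variable {a x : ℝ}

theorem summable_abs_rlCoeff_mul (hax : a < x) (hA : TaylorGrowth (x - a) A) (p : ℝ) :
    Summable fun k => |rlCoeff a p k x * A k| := by
  obtain ⟨K, hK0, hK⟩ := exists_abs_rlCoeff_le p
  have hx := sub_pos.2 hax
  refine ((hA.summable hx.le).mul_left (K * (x - a) ^ (-p))).of_nonneg_of_le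
    (fun k => abs_nonneg _) fun k => ?_
  rw [abs_mul]
  calc _ ≤ K * (x - a) ^ (-p) * ((x - a) ^ k / (k.factorial : ℝ)) * |A k| :=
        mul_le_mul_of_nonneg_right (hK a x hax k) (abs_nonneg _)
    _ = _ := by ring

theorem summable_rlCoeff_mul (hax : a < x) (hA : TaylorGrowth (x - a) A) (p : ℝ) :
    Summable fun k => rlCoeff a p k x * A k :=
  (hA.summable_abs_rlCoeff_mul hax p).of_abs

theorem summable_rlCoeffDeriv_mul (hax : a < x) (hA : TaylorGrowth (x - a) A) (p : ℝ) :
    Summable fun k => rlCoeffDeriv a p k x * A k := by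
  have hx := sub_pos.2 hax
  refine Summable.of_abs ((hA.summable hx.le).mul_left
    (|Real.Gamma (-p)|⁻¹ * (x - a) ^ (-p - 1)) |>.congr fun k => ?_)
  rw [abs_mul, abs_rlCoeffDeriv hax]
  ring

/-- The binomial coefficient cancels the factorials, so the double series is dominated by a product
of two convergent series. -/
theorem summable_leibniz (hax : a < x) (hA : TaylorGrowth (x - a) A)
    (hB : TaylorGrowth (x - a) B) (p : ℝ) :
    Summable fun ij : ℕ × ℕ =>
      ((ij.1 + ij.2).choose ij.1 : ℝ) * rlCoeff a p (ij.1 + ij.2) x * A ij.1 * B ij.2 := by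
  obtain ⟨K, hK0, hK⟩ := exists_abs_rlCoeff_le p
  have hx := sub_pos.2 hax
  have hs := ((hA.summable hx.le).mul_of_nonneg (hB.summable hx.le) (fun k => by positivity)
    fun k => by positivity).mul_left (K * (x - a) ^ (-p))
  refine Summable.of_abs (hs.of_nonneg_of_le (fun _ => abs_nonneg _) ?_)
  rintro ⟨i, j⟩
  have hi : (i.factorial : ℝ) ≠ 0 := by positivity
  have hj : (j.factorial : ℝ) ≠ 0 := by positivity
  have hij : ((i + j).factorial : ℝ) ≠ 0 := by positivity
  dsimp only
  rw [abs_mul, abs_mul, abs_mul, Nat.abs_cast]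
  calc _ ≤ ((i + j).choose i : ℝ) *
        (K * (x - a) ^ (-p) * ((x - a) ^ (i + j) / ((i + j).factorial : ℝ))) * |A i| * |B j| := by
        gcongr
        exact hK a x hax _
    _ = _ := by
        rw [Nat.cast_choose ℝ (Nat.le_add_right i j), Nat.add_sub_cancel_left, pow_add]
        field_simp

theorem summable_binom_mul_tsum (hax : a < x) (hA : TaylorGrowth (x - a) A)
    (hB : TaylorGrowth (x - a) B) (p : ℝ) :
    Summable fun n : ℕ => binom p n * A n * ∑' k : ℕ, rlCoeff a (p - n) k x * B k := by
  refine (summable_leibniz hax hA hB p).prod.congr fun n => ?_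
  rw [← tsum_mul_left]
  refine tsum_congr fun k => ?_
  rw [← binom_mul_rlCoeff_sub]
  ring

/-- The fractional Leibniz rule: it is the ordinary Leibniz rule with the double sum over the
orders of the derivatives rearranged. -/
theorem hasSum_leibniz (hax : a < x) (hA : TaylorGrowth (x - a) A)
    (hB : TaylorGrowth (x - a) B) (p : ℝ) :
    HasSum (fun m : ℕ => rlCoeff a p m x *
        ∑ i ∈ Finset.range (m + 1), (m.choose i : ℝ) * A i * B (m - i))
      (∑' n : ℕ, binom p n * A n * ∑' k : ℕ, rlCoeff a (p - n) k x * B k) := by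
  have hs := summable_leibniz hax hA hB p
  have e : ∑' n : ℕ, binom p n * A n * ∑' k : ℕ, rlCoeff a (p - n) k x * B k =
      ∑' ij : ℕ × ℕ,
        ((ij.1 + ij.2).choose ij.1 : ℝ) * rlCoeff a p (ij.1 + ij.2) x * A ij.1 * B ij.2 := by
    rw [hs.tsum_prod]
    refine tsum_congr fun n => ?_
    rw [← tsum_mul_left]
    refine tsum_congr fun k => ?_
    rw [← binom_mul_rlCoeff_sub]
    ring
  rw [e]
  have h1 := (Finset.HasAntidiagonal.sigmaAntidiagonalEquivProd (A := ℕ)).hasSum_iff.2 hs.hasSum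
  have h2 := h1.sigma fun m => (Finset.HasAntidiagonal.antidiagonal m).hasSum fun ij : ℕ × ℕ =>
    ((ij.1 + ij.2).choose ij.1 : ℝ) * rlCoeff a p (ij.1 + ij.2) x * A ij.1 * B ij.2
  refine h2.congr_fun fun m => ?_
  rw [Finset.Nat.sum_antidiagonal_eq_sum_range_succ_mk, Finset.mul_sum]
  refine Finset.sum_congr rfl fun i hi => ?_
  dsimp only
  rw [Nat.add_sub_cancel' (Finset.mem_range_succ_iff.1 hi)]
  ring

end TaylorGrowth

/-- Termwise differentiation of the series with coefficients `rlCoeff`. -/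
theorem hasDerivAt_tsum_rlCoeff_mul {a x : ℝ} (hax : a < x) (p : ℝ) {A A' : ℕ → ℝ → ℝ}
    {B : ℕ → ℝ} (hB : TaylorGrowth (x - a) B)
    (hd : ∀ᶠ t in 𝓝 x, ∀ k, HasDerivAt (A k) (A' k t) t ∧ |A k t| ≤ B k ∧ |A' k t| ≤ B k) :
    HasDerivAt (fun t => ∑' k : ℕ, rlCoeff a p k t * A k t)
      (∑' k : ℕ, (rlCoeffDeriv a p k x * A k x + rlCoeff a p k x * A' k x)) x := by
  obtain ⟨R, hR, hBR⟩ := hB.exists_gt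
  have hx := sub_pos.2 hax
  have hR0 : 0 < R := hx.trans hR
  obtain ⟨K, hK0, hK⟩ := exists_abs_rlCoeff_le p
  have hc : ∀ q : ℝ, ContinuousAt (fun t : ℝ => (t - a) ^ q) x := fun q =>
    (continuousAt_id.sub continuousAt_const).rpow_const (Or.inl hx.ne')
  have ev : ∀ᶠ t in 𝓝 x, a < t ∧ t - a < R ∧ (t - a) ^ (-p) < (x - a) ^ (-p) + 1 ∧
      (t - a) ^ (-p - 1) < (x - a) ^ (-p - 1) + 1 ∧
      ∀ k, HasDerivAt (A k) (A' k t) t ∧ |A k t| ≤ B k ∧ |A' k t| ≤ B k := by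
    have h1 : ContinuousAt (fun t : ℝ => t - a) x := by fun_prop
    exact (lt_mem_nhds hax).and ((h1.eventually_lt_const hR).and
      (((hc (-p)).eventually_lt_const (lt_add_one _)).and
        (((hc (-p - 1)).eventually_lt_const (lt_add_one _)).and hd)))
  obtain ⟨δ, hδ, hball⟩ := Metric.eventually_nhds_iff_ball.1 ev
  have hxb : x ∈ Metric.ball x δ := Metric.mem_ball_self hδ
  set L := |Real.Gamma (-p)|⁻¹ * ((x - a) ^ (-p - 1) + 1) + K * ((x - a) ^ (-p) + 1) with hL
  refine hasDerivAt_tsum_of_isPreconnected (y₀ := x)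
    (u := fun k => L * (|B k| * (R ^ k / (k.factorial : ℝ))))
    (g' := fun k t => rlCoeffDeriv a p k t * A k t + rlCoeff a p k t * A' k t)
    ((hBR.summable hR0.le).mul_left L) Metric.isOpen_ball
    (convex_ball x δ).isPreconnected (fun k t ht => ?_) (fun k t ht => ?_) hxb ?_ hxb
  · obtain ⟨h1, -, -, -, h5⟩ := hball t ht
    exact (hasDerivAt_rlCoeff h1 p k).mul (h5 k).1
  · obtain ⟨h1, h2, h3, h4, h5⟩ := hball t ht
    have ht0 := sub_pos.2 h1
    have hB0 := le_abs_self (B k)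
    rw [Real.norm_eq_abs]
    refine (abs_add_le _ _).trans ?_
    rw [abs_mul, abs_mul, abs_rlCoeffDeriv h1]
    have e1 : (t - a) ^ k ≤ R ^ k := pow_le_pow_left₀ ht0.le h2.le k
    have p1 : 0 < (t - a) ^ (-p) := Real.rpow_pos_of_pos ht0 _
    have p2 : 0 < (t - a) ^ (-p - 1) := Real.rpow_pos_of_pos ht0 _
    have b1 : |Real.Gamma (-p)|⁻¹ * (t - a) ^ (-p - 1) * ((t - a) ^ k / (k.factorial : ℝ)) * |A k t|
        ≤ |Real.Gamma (-p)|⁻¹ * ((x - a) ^ (-p - 1) + 1) * (R ^ k / (k.factorial : ℝ)) * |B k| := by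
      have := (h5 k).2.1.trans hB0
      gcongr
    have b2 : |rlCoeff a p k t| * |A' k t| ≤
        K * ((x - a) ^ (-p) + 1) * (R ^ k / (k.factorial : ℝ)) * |B k| := by
      refine mul_le_mul ((hK a t h1 k).trans ?_) ((h5 k).2.2.trans hB0) (abs_nonneg _) ?_
      · gcongr
      · have : 0 ≤ (x - a) ^ (-p) + 1 := (p1.trans h3).le
        positivity
    calc _ ≤ _ := add_le_add b1 b2
      _ = _ := by rw [hL]; ring
  · have hg : TaylorGrowth (x - a) fun k => A k x :=
      hB.mono fun k => (((hball x hxb).2.2.2.2 k).2.1).trans (le_abs_self _)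
    exact hg.summable_rlCoeff_mul hax p

/-! ### Functions with a long Taylor radius -/

/-- A function with a long Taylor radius at `x` agrees on `[a, c)` with one that has a power series
on a full ball around `x`, to which the calculus of analytic functions applies. -/
theorem taylorReaches_iff {a x : ℝ} (hax : a < x) {f : ℝ → ℝ} :
    TaylorReaches a x f ↔
      ∃ (F : ℝ → ℝ) (q : FormalMultilinearSeries ℝ ℝ ℝ) (r : ENNReal) (c : ℝ),
        HasFPowerSeriesOnBall F q x r ∧ ENNReal.ofReal (x - a) < r ∧ x < c ∧
          EqOn f F (Ico a c) := by
  constructor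
  · rintro ⟨c, hc, q, r, hr, h⟩
    have hq : HasFPowerSeriesOnBall (fun z => q.sum (z - x)) q x r := by
      have h1 := (q.hasFPowerSeriesOnBall (h.r_pos.trans_le h.r_le)).comp_sub x
      rw [zero_add] at h1
      exact h1.mono h.r_pos h.r_le
    -- `[a, 2 x - a)` is the largest such interval that certainly stays inside the ball
    refine ⟨_, q, r, min c (2 * x - a), hq, hr, lt_min hc (by linarith), fun y hy => ?_⟩
    have hy1 : y < c := hy.2.trans_le (min_le_left _ _)
    have hy2 : y < 2 * x - a := hy.2.trans_le (min_le_right _ _)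
    have hmem : y - x ∈ Metric.eball (0 : ℝ) r := by
      rw [Metric.mem_eball, edist_dist, dist_zero_right, Real.norm_eq_abs]
      refine lt_of_le_of_lt (ENNReal.ofReal_le_ofReal ?_) hr
      rw [abs_le]
      constructor <;> linarith [hy.1]
    have h1 := h.hasSum (y := y - x) (Or.inr (by simpa using ⟨hy.1, hy1⟩)) hmem
    have h2 := hq.hasSum hmem
    simpa using h1.unique h2
  · rintro ⟨F, q, r, c, hF, hr, hc, heq⟩
    refine ⟨c, hc, q, r, hr, ⟨hF.r_le, hF.r_pos, fun {y} hy hmem => ?_⟩⟩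
    have hy' : x + y ∈ Ico a c := by
      rcases hy with hy | hy
      · rw [hy]; exact ⟨hax.le, hc⟩
      · exact hy
    rw [heq hy']
    exact hF.hasSum hmem

theorem HasFPowerSeriesOnBall.iteratedDeriv_eq {F : ℝ → ℝ} {q : FormalMultilinearSeries ℝ ℝ ℝ}
    {x : ℝ} {r : ENNReal} (h : HasFPowerSeriesOnBall F q x r) (k : ℕ) :
    iteratedDeriv k F x = (k.factorial : ℝ) * q k fun _ => 1 := by
  rw [iteratedDeriv_eq_iteratedFDeriv, ← h.factorial_smul 1 k, nsmul_eq_mul]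

theorem HasFPowerSeriesOnBall.abs_iteratedDeriv_le {F : ℝ → ℝ}
    {q : FormalMultilinearSeries ℝ ℝ ℝ} {x : ℝ} {r : ENNReal} (h : HasFPowerSeriesOnBall F q x r)
    (k : ℕ) : |iteratedDeriv k F x| ≤ (k.factorial : ℝ) * ‖q k‖ := by
  rw [h.iteratedDeriv_eq, abs_mul, Nat.abs_cast]
  gcongr
  simp

/-- Cauchy estimates for a power series that are uniform under a small change of the centre. -/
theorem FormalMultilinearSeries.exists_norm_changeOrigin_mul_pow_le
    (q : FormalMultilinearSeries ℝ ℝ ℝ) {r r' : NNReal} (h : (r : ENNReal) + r' < q.radius) :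
    ∃ C : ℝ, ∀ y : ℝ, ‖y‖₊ ≤ r → ∀ k : ℕ, ‖q.changeOrigin y k‖ * (r' : ℝ) ^ k ≤ C := by
  have hs := NNReal.summable_sigma.1 (q.changeOriginSeries_summable_aux₁ h)
  have hr : (r : ENNReal) < q.radius := lt_of_le_of_lt le_self_add h
  refine ⟨((∑' k : ℕ, ∑' s : Σ l : ℕ, { s : Finset (Fin (k + l)) // s.card = l },
    ‖q (k + s.1)‖₊ * r ^ s.1 * r' ^ k : NNReal) : ℝ), fun y hy k => ?_⟩
  have hyr : (‖y‖₊ : ENNReal) < q.radius := lt_of_le_of_lt (ENNReal.coe_le_coe.2 hy) hr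
  have hk := q.changeOriginSeries_summable_aux₂ hr k
  have hle : ∀ s : Σ l : ℕ, { s : Finset (Fin (k + l)) // s.card = l },
      ‖q (k + s.1)‖₊ * ‖y‖₊ ^ s.1 ≤ ‖q (k + s.1)‖₊ * r ^ s.1 := fun s => by gcongr
  have h1 : ‖q.changeOrigin y k‖₊ ≤
      ∑' s : Σ l : ℕ, { s : Finset (Fin (k + l)) // s.card = l }, ‖q (k + s.1)‖₊ * r ^ s.1 :=
    (q.nnnorm_changeOrigin_le k hyr).trans
      ((NNReal.summable_of_le hle hk).tsum_le_tsum hle hk)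
  have h2 : ‖q.changeOrigin y k‖₊ * r' ^ k ≤
      ∑' s : Σ l : ℕ, { s : Finset (Fin (k + l)) // s.card = l },
        ‖q (k + s.1)‖₊ * r ^ s.1 * r' ^ k := by
    rw [NNReal.tsum_mul_right]
    exact mul_le_mul_left h1 _
  exact_mod_cast h2.trans (hs.2.le_tsum k fun _ _ => zero_le)

namespace TaylorReaches

variable {a x : ℝ} {f : ℝ → ℝ}

theorem analyticAt (hax : a < x) (h : TaylorReaches a x f) : AnalyticAt ℝ f x := by
  obtain ⟨F, q, r, c, hF, -, hc, heq⟩ := (taylorReaches_iff hax).1 h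
  exact hF.analyticAt.congr (heq.symm.eventuallyEq_of_mem (Ico_mem_nhds hax hc))

/-- The derivatives of `f` near `x` have a common majorant of the growth that the Taylor radius of
`f` at `x` prescribes, and the Taylor radius stays long at the points near `x`. -/
theorem exists_majorant (hax : a < x) (h : TaylorReaches a x f) :
    ∃ B : ℕ → ℝ, TaylorGrowth (x - a) B ∧
      ∀ᶠ t in 𝓝 x, TaylorReaches a t f ∧ ∀ k, |iteratedDeriv k f t| ≤ B k := by
  obtain ⟨F, q, r, c, hF, hr, hc, heq⟩ := (taylorReaches_iff hax).1 h
  have hx := sub_pos.2 hax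
  obtain ⟨ρ, hρ1, hρ2⟩ := ENNReal.lt_iff_exists_nnreal_btwn.1 hr
  have hρ : x - a < ρ := by
    rwa [← ENNReal.ofReal_coe_nnreal, ENNReal.ofReal_lt_ofReal_iff_of_nonneg hx.le] at hρ1
  -- `ρ` is split into the growth rate `σ > x - a` and the size `ρ - σ` of the neighbourhood of `x`
  set σ : ℝ := (x - a + ρ) / 2 with hσ
  have hσ0 : 0 < σ := by rw [hσ]; linarith
  have hδ0 : 0 < ρ - σ := by rw [hσ]; linarith
  have hsum : ((ρ - σ).toNNReal : ENNReal) + (σ.toNNReal : ENNReal) = ρ := by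
    rw [← ENNReal.coe_add, ← Real.toNNReal_add hδ0.le hσ0.le]
    simp
  obtain ⟨C, hC⟩ := q.exists_norm_changeOrigin_mul_pow_le (r := (ρ - σ).toNNReal)
    (r' := σ.toNNReal) (by rw [hsum]; exact hρ2.trans_le hF.r_le)
  refine ⟨fun k => C * (k.factorial : ℝ) / σ ^ k, ⟨|C|, σ, by rw [hσ]; linarith, fun k => ?_⟩, ?_⟩
  · rw [abs_div, abs_mul, Nat.abs_cast, abs_pow, abs_of_pos hσ0]
  have ev : ∀ᶠ t in 𝓝 x, dist t x < ρ - σ := Metric.ball_mem_nhds x hδ0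
  filter_upwards [ev, lt_mem_nhds hax, gt_mem_nhds hc] with t ht hat htc
  rw [Real.dist_eq] at ht
  have hn : ‖t - x‖₊ ≤ (ρ - σ).toNNReal := by
    rw [← NNReal.coe_le_coe, Real.coe_toNNReal _ hδ0.le, coe_nnnorm]
    exact ht.le
  have hn' : (‖t - x‖₊ : ENNReal) + ENNReal.ofReal σ < r :=
    lt_of_le_of_lt (add_le_add_left (ENNReal.coe_le_coe.2 hn) _) (hsum.trans_lt hρ2)
  have hFt := hF.changeOrigin (y := t - x) (lt_of_le_of_lt le_self_add hn')
  rw [add_sub_cancel] at hFt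
  have hta : t - a < σ := by
    have := (abs_lt.1 ht).2
    rw [hσ] at this ⊢
    linarith
  refine ⟨(taylorReaches_iff hat).2 ⟨F, _, _, c, hFt, ?_, htc, heq⟩, fun k => ?_⟩
  · refine lt_of_le_of_lt (ENNReal.ofReal_le_ofReal hta.le) ?_
    rwa [lt_tsub_iff_left]
  · have e : f =ᶠ[𝓝 t] F := heq.eventuallyEq_of_mem (Ico_mem_nhds hat htc)
    rw [e.iteratedDeriv_eq]
    refine (hFt.abs_iteratedDeriv_le k).trans ?_
    rw [le_div_iff₀ (by positivity)]
    have := hC (t - x) hn k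
    rw [Real.coe_toNNReal _ hσ0.le] at this
    calc _ = (k.factorial : ℝ) * (‖q.changeOrigin (t - x) k‖ * σ ^ k) := by ring
      _ ≤ (k.factorial : ℝ) * C := by gcongr
      _ = _ := mul_comm _ _

theorem eventually (hax : a < x) (h : TaylorReaches a x f) :
    ∀ᶠ t in 𝓝 x, TaylorReaches a t f := by
  obtain ⟨B, -, hB⟩ := h.exists_majorant hax
  exact hB.mono fun t ht => ht.1

theorem taylorGrowth (hax : a < x) (h : TaylorReaches a x f) :
    TaylorGrowth (x - a) fun k => iteratedDeriv k f x := by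
  obtain ⟨B, hB, hB'⟩ := h.exists_majorant hax
  exact hB.mono fun k => (hB'.self_of_nhds.2 k).trans (le_abs_self _)

theorem hasSum_taylor (hax : a < x) (h : TaylorReaches a x f) {y : ℝ} (hy : y ∈ Icc a x) :
    HasSum (fun k : ℕ => iteratedDeriv k f x * ((y - x) ^ k / (k.factorial : ℝ))) (f y) := by
  obtain ⟨F, q, r, c, hF, hr, hc, heq⟩ := (taylorReaches_iff hax).1 h
  have hmem : y - x ∈ Metric.eball (0 : ℝ) r := by
    rw [Metric.mem_eball, edist_dist, dist_zero_right, Real.norm_eq_abs]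
    refine lt_of_le_of_lt (ENNReal.ofReal_le_ofReal ?_) hr
    rw [abs_le]
    constructor <;> linarith [hy.1, hy.2]
  have h1 := hF.hasSum hmem
  rw [add_sub_cancel, ← heq ⟨hy.1, hy.2.trans_lt hc⟩] at h1
  refine h1.congr_fun fun k => ?_
  have e : f =ᶠ[𝓝 x] F := heq.eventuallyEq_of_mem (Ico_mem_nhds hax hc)
  have hf : (k.factorial : ℝ) ≠ 0 := by positivity
  have e2 : (q k fun _ => y - x) = (y - x) ^ k * q k fun _ => 1 := by
    simp
  rw [e.iteratedDeriv_eq, hF.iteratedDeriv_eq, e2]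
  field_simp

end TaylorReaches

/-! ### The series of the Riemann--Liouville operator -/

/-- The series `∑_k binom(p, k) (t - a)^{k - p} / Γ(k - p + 1) f^{(k)}(t)`. -/
noncomputable def rlSeries (a p : ℝ) (f : ℝ → ℝ) (t : ℝ) : ℝ :=
  ∑' k : ℕ, rlCoeff a p k t * iteratedDeriv k f t

/-- The coefficients of order `p + 1` are those obtained by differentiating the series of order
`p`. -/
theorem hasSum_rlCoeffDeriv_add {a x : ℝ} (hax : a < x) (p : ℝ) {A : ℕ → ℝ}
    (hA : TaylorGrowth (x - a) A) :
    HasSum (fun k : ℕ => rlCoeffDeriv a p k x * A k + rlCoeff a p k x * A (k + 1))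
      (∑' k : ℕ, rlCoeff a (p + 1) k x * A k) := by
  have hx := sub_pos.2 hax
  have h1 := (hA.summable_rlCoeff_mul hax (p + 1)).tsum_eq_zero_add
  have h2 := (hA.summable_rlCoeffDeriv_mul hax p)
  have h3 := ((hA.shift hx.le).summable_rlCoeff_mul hax p)
  have h4 := (summable_nat_add_iff 1).2 h2
  have e : ∑' k : ℕ, rlCoeff a (p + 1) k x * A k =
      ∑' k : ℕ, rlCoeffDeriv a p k x * A k + ∑' k : ℕ, rlCoeff a p k x * A (k + 1) := by
    rw [h1, h2.tsum_eq_zero_add, add_assoc, ← h4.tsum_add h3, rlCoeff_add_one_zero]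
    congr 1
    exact tsum_congr fun k => by rw [rlCoeff_add_one_succ, add_mul]
  rw [e]
  exact h2.hasSum.add h3.hasSum

theorem hasDerivAt_rlSeries {a x : ℝ} (hax : a < x) (p : ℝ) {f : ℝ → ℝ}
    (hf : TaylorReaches a x f) :
    HasDerivAt (rlSeries a p f) (rlSeries a (p + 1) f x) x := by
  have hx := sub_pos.2 hax
  obtain ⟨B, hB, hB'⟩ := hf.exists_majorant hax
  have h := hasDerivAt_tsum_rlCoeff_mul hax p (A := fun k => iteratedDeriv k f)
    (A' := fun k => iteratedDeriv (k + 1) f) (hB.abs_add (hB.shift hx.le) hx.le) ?_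
  · refine h.congr_deriv ?_
    exact (hasSum_rlCoeffDeriv_add hax p (hf.taylorGrowth hax)).tsum_eq
  · filter_upwards [hB', lt_mem_nhds hax] with t ht hat k
    have h0 := ht.2 k
    have h1 := ht.2 (k + 1)
    refine ⟨?_, ?_, ?_⟩
    · rw [iteratedDeriv_succ]
      have hA : AnalyticAt ℝ f t := ht.1.analyticAt hat
      have : DifferentiableAt ℝ (iteratedDeriv k f) t := by
        rw [iteratedDeriv_eq_iterate]
        exact (hA.iterated_deriv k).differentiableAt
      exact this.hasDerivAt
    · exact (h0.trans (le_abs_self _)).trans (le_add_of_nonneg_right (abs_nonneg _))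
    · exact (h1.trans (le_abs_self _)).trans (le_add_of_nonneg_left (abs_nonneg _))

theorem iteratedDeriv_rlSeries {a : ℝ} {f : ℝ → ℝ} (n : ℕ) (p : ℝ) {x : ℝ} (hax : a < x)
    (hf : TaylorReaches a x f) :
    iteratedDeriv n (rlSeries a p f) x = rlSeries a (p + n) f x := by
  induction n generalizing p with
  | zero => simp
  | succ n ih =>
    have e : deriv (rlSeries a p f) =ᶠ[𝓝 x] rlSeries a (p + 1) f := by
      filter_upwards [hf.eventually hax, lt_mem_nhds hax] with t ht hat
      exact (hasDerivAt_rlSeries hat p ht).deriv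
    rw [iteratedDeriv_succ', e.iteratedDeriv_eq, ih]
    push_cast
    ring_nf

theorem integral_pow_mul_rpow {a x : ℝ} (hax : a < x) {p : ℝ} (hp : p < 0) (k : ℕ) :
    ∫ τ in a..x, (τ - x) ^ k * (x - τ) ^ (-1 - p) =
      (-1) ^ k * ((x - a) ^ ((k : ℝ) - p) / ((k : ℝ) - p)) := by
  have hk : (0 : ℝ) ≤ k := Nat.cast_nonneg k
  have h1 : ∀ τ : ℝ, (τ - x) ^ k * (x - τ) ^ (-1 - p) =
      (fun s : ℝ => (-1) ^ k * (s ^ k * s ^ (-1 - p))) (x - τ) := fun τ => by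
    have : τ - x = -1 * (x - τ) := by ring
    simp only []
    rw [this, mul_pow]
    ring
  simp_rw [h1]
  rw [intervalIntegral.integral_comp_sub_left
    (fun s : ℝ => (-1) ^ k * (s ^ k * s ^ (-1 - p))), sub_self, intervalIntegral.integral_const_mul]
  congr 1
  have h2 : ∫ s in (0 : ℝ)..(x - a), s ^ k * s ^ (-1 - p) =
      ∫ s in (0 : ℝ)..(x - a), s ^ ((k : ℝ) - p - 1) := by
    refine intervalIntegral.integral_congr_ae (Eventually.of_forall fun s hs => ?_)
    rw [uIoc_of_le (sub_pos.2 hax).le] at hs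
    rw [← Real.rpow_natCast, ← Real.rpow_add hs.1]
    ring_nf
  rw [h2, integral_rpow (Or.inl (by linarith)), sub_add_cancel,
    Real.zero_rpow (by linarith), sub_zero]

/-- For a negative order the Taylor series at `x` is integrated termwise. -/
theorem hasSum_rlCoeff_mul_integral {a x : ℝ} (hax : a < x) {p : ℝ} (hp : p < 0) {f : ℝ → ℝ}
    (hf : TaylorReaches a x f) :
    HasSum (fun k : ℕ => rlCoeff a p k x * iteratedDeriv k f x)
      (1 / Real.Gamma (-p) * ∫ τ in a..x, (x - τ) ^ (-1 - p) * f τ) := by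
  have hx := sub_pos.2 hax
  have hs := (hf.taylorGrowth hax).summable hx.le
  have hint : IntervalIntegrable (fun τ : ℝ => (x - τ) ^ (-1 - p)) MeasureTheory.volume a x := by
    have := (intervalIntegral.intervalIntegrable_rpow' (a := x - a) (b := x - x) (r := -1 - p)
      (by linarith)).comp_sub_left x
    simpa using this
  have key : HasSum (fun k : ℕ => ∫ τ in a..x,
        (iteratedDeriv k f x / (k.factorial : ℝ)) * ((τ - x) ^ k * (x - τ) ^ (-1 - p)))
      (∫ τ in a..x, (x - τ) ^ (-1 - p) * f τ) := by
    refine intervalIntegral.hasSum_integral_of_dominated_convergence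
      (fun k τ => |iteratedDeriv k f x| * ((x - a) ^ k / (k.factorial : ℝ)) * (x - τ) ^ (-1 - p))
      (fun k => ?_) (fun k => Eventually.of_forall fun τ hτ => ?_)
      (Eventually.of_forall fun τ _ => hs.mul_right _) ?_
      (Eventually.of_forall fun τ hτ => ?_)
    · exact Measurable.aestronglyMeasurable (by fun_prop)
    · rw [uIoc_of_le hax.le] at hτ
      have h0 : 0 ≤ x - τ := sub_nonneg.2 hτ.2
      rw [Real.norm_eq_abs, abs_mul, abs_div, abs_mul, abs_pow, Nat.abs_cast, abs_sub_comm,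
        abs_of_nonneg h0, abs_of_nonneg (Real.rpow_nonneg h0 _)]
      have h1 : (x - τ) ^ k ≤ (x - a) ^ k := by
        gcongr
        exact hτ.1.le
      have h2 : 0 ≤ (x - τ) ^ (-1 - p) := Real.rpow_nonneg h0 _
      calc _ = |iteratedDeriv k f x| * ((x - τ) ^ k / (k.factorial : ℝ)) * (x - τ) ^ (-1 - p) := by
            ring
        _ ≤ _ := by gcongr
    · simp only [tsum_mul_right]
      exact hint.const_mul _
    · rw [uIoc_of_le hax.le] at hτ
      have := (hf.hasSum_taylor hax ⟨hτ.1.le, hτ.2⟩).mul_left ((x - τ) ^ (-1 - p))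
      exact this.congr_fun fun k => by ring
  refine (key.mul_left (1 / Real.Gamma (-p))).congr_fun fun k => ?_
  have hk : (k : ℝ) - p ≠ 0 := by
    have : (0 : ℝ) ≤ k := Nat.cast_nonneg k
    linarith
  rw [intervalIntegral.integral_const_mul, integral_pow_mul_rpow hax hp]
  have e : rlCoeff a p k x =
      binom p k / Real.Gamma ((k : ℝ) - p) * ((x - a) ^ ((k : ℝ) - p) / ((k : ℝ) - p)) := by
    unfold rlCoeff
    rw [Real.Gamma_add_one hk]
    simp only [div_eq_mul_inv, mul_inv]
    ring
  rw [e, binom_div_Gamma]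
  simp only [div_eq_mul_inv, mul_inv]
  ring

theorem media_add_one_nonneg (p : ℝ) : 0 ≤ media p + 1 := by
  unfold media
  split_ifs with h
  · have := Int.floor_nonneg.2 h
    omega
  · simp

theorem lt_media_add_one (p : ℝ) : p < media p + 1 := by
  unfold media
  split_ifs with h
  · exact Int.lt_floor_add_one p
  · push_cast
    linarith

/-- The defining integral has the negative order `p - m` and equals its series near `x`; its `m`
derivatives raise the order of the series to `p`. -/
theorem RL_eq_rlSeries {a x : ℝ} (hax : a < x) (p : ℝ) {f : ℝ → ℝ} (hf : TaylorReaches a x f) :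
    RL a p f x = rlSeries a p f x := by
  -- `m` derivatives are applied to the integral, which is the operator of order `p - m < 0`
  set m : ℕ := (media p + 1).toNat with hm
  have hm' : (m : ℝ) = media p + 1 := by
    have : (m : ℤ) = media p + 1 := Int.toNat_of_nonneg (media_add_one_nonneg p)
    exact_mod_cast this
  have hq : p - m < 0 := by
    have := lt_media_add_one p
    linarith
  have hG : Real.Gamma (-(p - m)) ≠ 0 := (Real.Gamma_pos_of_pos (by linarith)).ne'
  have e : (fun s => ∫ τ in a..s, (s - τ) ^ ((media p : ℝ) - p) * f τ) =ᶠ[𝓝 x]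
      fun s => Real.Gamma (-(p - m)) * rlSeries a (p - m) f s := by
    filter_upwards [hf.eventually hax, lt_mem_nhds hax] with s hs has
    have h1 := (hasSum_rlCoeff_mul_integral has hq hs).tsum_eq
    have h2 : -1 - (p - m) = (media p : ℝ) - p := by rw [hm']; ring
    rw [rlSeries, h1, h2]
    field_simp
  rw [RL, e.iteratedDeriv_eq, iteratedDeriv_const_mul_field, iteratedDeriv_rlSeries _ _ hax hf,
    sub_add_cancel]
  have h3 : 1 + (media p : ℝ) - p = -(p - m) := by rw [hm']; ring
  rw [h3]
  field_simp

/-- The series representation of the Riemann--Liouville operator on functions with a long Taylor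
radius. -/
theorem hasSum_RL {a x : ℝ} (hax : a < x) (p : ℝ) {f : ℝ → ℝ} (hf : TaylorReaches a x f) :
    HasSum (fun k : ℕ => rlCoeff a p k x * iteratedDeriv k f x) (RL a p f x) := by
  rw [RL_eq_rlSeries hax p hf]
  exact ((hf.taylorGrowth hax).summable_rlCoeff_mul hax p).hasSum

/-! ### Higher chain rule along a graph -/

/-- `∂g/∂x`. -/
noncomputable def sliceDx (g : ℝ × ℝ → ℝ) (z : ℝ × ℝ) : ℝ := deriv (fun y => g (y, z.2)) z.1

/-- `∂g/∂u`. -/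
noncomputable def sliceDu (g : ℝ × ℝ → ℝ) (z : ℝ × ℝ) : ℝ := deriv (fun w => g (z.1, w)) z.2

/-- `∂^k g/∂u^k` at `(y, U)`, as a function of `y`. -/
noncomputable def uDeriv (k : ℕ) (g : ℝ × ℝ → ℝ) (U y : ℝ) : ℝ :=
  iteratedDeriv k (fun w => g (y, w)) U

theorem sliceDx_eq_fderiv {g : ℝ × ℝ → ℝ} {z : ℝ × ℝ} (h : DifferentiableAt ℝ g z) :
    sliceDx g z = fderiv ℝ g z (1, 0) :=
  (h.hasFDerivAt.comp_hasDerivAt z.1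
    ((hasDerivAt_id z.1).prodMk (hasDerivAt_const z.1 z.2))).deriv

theorem sliceDu_eq_fderiv {g : ℝ × ℝ → ℝ} {z : ℝ × ℝ} (h : DifferentiableAt ℝ g z) :
    sliceDu g z = fderiv ℝ g z (0, 1) :=
  (h.hasFDerivAt.comp_hasDerivAt z.2
    ((hasDerivAt_const z.2 z.1).prodMk (hasDerivAt_id z.2))).deriv

theorem sliceDx_eventuallyEq {g : ℝ × ℝ → ℝ} {z : ℝ × ℝ} (h : AnalyticAt ℝ g z) :
    sliceDx g =ᶠ[𝓝 z] fun w => fderiv ℝ g w (1, 0) :=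
  h.eventually_analyticAt.mono fun _ hw => sliceDx_eq_fderiv hw.differentiableAt

theorem sliceDu_eventuallyEq {g : ℝ × ℝ → ℝ} {z : ℝ × ℝ} (h : AnalyticAt ℝ g z) :
    sliceDu g =ᶠ[𝓝 z] fun w => fderiv ℝ g w (0, 1) :=
  h.eventually_analyticAt.mono fun _ hw => sliceDu_eq_fderiv hw.differentiableAt

theorem AnalyticAt.fderiv_apply_const {E : Type*} [NormedAddCommGroup E] [NormedSpace ℝ E]
    {g : E → ℝ} {z : E} (h : AnalyticAt ℝ g z) (v : E) :
    AnalyticAt ℝ (fun w => _root_.fderiv ℝ g w v) z :=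
  (ContinuousLinearMap.apply ℝ ℝ v).analyticAt _ |>.comp h.fderiv

theorem AnalyticAt.sliceDx {g : ℝ × ℝ → ℝ} {z : ℝ × ℝ} (h : AnalyticAt ℝ g z) :
    AnalyticAt ℝ (sliceDx g) z :=
  (h.fderiv_apply_const _).congr (sliceDx_eventuallyEq h).symm

theorem AnalyticAt.sliceDu {g : ℝ × ℝ → ℝ} {z : ℝ × ℝ} (h : AnalyticAt ℝ g z) :
    AnalyticAt ℝ (sliceDu g) z :=
  (h.fderiv_apply_const _).congr (sliceDu_eventuallyEq h).symm

theorem fderiv_fderiv_apply_const {E : Type*} [NormedAddCommGroup E] [NormedSpace ℝ E]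
    {g : E → ℝ} {z : E} (h : AnalyticAt ℝ g z) (v w : E) :
    fderiv ℝ (fun y => fderiv ℝ g y v) z w = fderiv ℝ (fderiv ℝ g) z w v := by
  have := (ContinuousLinearMap.apply ℝ ℝ v).hasFDerivAt.comp z
    h.fderiv.differentiableAt.hasFDerivAt
  exact DFunLike.congr_fun this.fderiv w

theorem sliceDx_sliceDu {g : ℝ × ℝ → ℝ} {z : ℝ × ℝ} (h : AnalyticAt ℝ g z) :
    sliceDx (sliceDu g) z = sliceDu (sliceDx g) z := by
  rw [sliceDx_eq_fderiv h.sliceDu.differentiableAt, sliceDu_eq_fderiv h.sliceDx.differentiableAt,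
    (sliceDu_eventuallyEq h).fderiv_eq, (sliceDx_eventuallyEq h).fderiv_eq,
    fderiv_fderiv_apply_const h, fderiv_fderiv_apply_const h]
  have hs : IsSymmSndFDerivAt ℝ g z :=
    ContDiffAt.isSymmSndFDerivAt (n := ⊤) h.contDiffAt (by simp)
  exact hs.eq _ _

theorem uDeriv_zero (g : ℝ × ℝ → ℝ) (U : ℝ) : uDeriv 0 g U = fun y => g (y, U) := by
  funext y
  simp [uDeriv]

theorem uDeriv_succ (k : ℕ) (g : ℝ × ℝ → ℝ) (U : ℝ) :
    uDeriv (k + 1) g U = uDeriv k (sliceDu g) U := by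
  funext y
  simp only [uDeriv, iteratedDeriv_succ']
  rfl

theorem analyticAt_uDeriv {g : ℝ × ℝ → ℝ} {x U : ℝ} (h : AnalyticAt ℝ g (x, U)) (k : ℕ) :
    AnalyticAt ℝ (uDeriv k g U) x := by
  induction k generalizing g with
  | zero =>
    rw [uDeriv_zero]
    exact AnalyticAt.comp (f := fun y => (y, U)) h (analyticAt_id.prod analyticAt_const)
  | succ k ih => rw [uDeriv_succ]; exact ih h.sliceDu

/-- Since partial derivatives commute, `∂/∂y` of `∂^k g/∂u^k` is the `k`-th `u`-derivative of
`∂g/∂x`. -/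
theorem deriv_uDeriv {g : ℝ × ℝ → ℝ} {x U : ℝ} (h : AnalyticAt ℝ g (x, U)) (k : ℕ) :
    deriv (uDeriv k g U) =ᶠ[𝓝 x] uDeriv k (sliceDx g) U := by
  induction k generalizing g with
  | zero => exact Eventually.of_forall fun y => by rw [uDeriv_zero, uDeriv_zero]; rfl
  | succ k ih =>
    rw [uDeriv_succ, uDeriv_succ]
    refine (ih h.sliceDu).trans ?_
    have h1 : ∀ᶠ z in 𝓝 (x, U), sliceDx (sliceDu g) z = sliceDu (sliceDx g) z :=
      h.eventually_analyticAt.mono fun z hz => sliceDx_sliceDu hz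
    filter_upwards [h1.curry_nhds] with y hy
    exact EventuallyEq.iteratedDeriv_eq k hy

theorem AnalyticAt.graph {g : ℝ × ℝ → ℝ} {u : ℝ → ℝ} {x : ℝ} (hg : AnalyticAt ℝ g (x, u x))
    (hu : AnalyticAt ℝ u x) : AnalyticAt ℝ (fun y => g (y, u y)) x :=
  AnalyticAt.comp (f := fun y => (y, u y)) hg (analyticAt_id.prod hu)

theorem hasDerivAt_graph {g : ℝ × ℝ → ℝ} {u : ℝ → ℝ} {x : ℝ} (hg : AnalyticAt ℝ g (x, u x))
    (hu : AnalyticAt ℝ u x) :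
    HasDerivAt (fun y => g (y, u y)) (sliceDx g (x, u x) + deriv u x * sliceDu g (x, u x)) x := by
  have hd := hg.differentiableAt
  have h1 := hd.hasFDerivAt.comp_hasDerivAt (f := fun y => (y, u y)) x
    ((hasDerivAt_id x).prodMk hu.differentiableAt.hasDerivAt)
  refine h1.congr_deriv ?_
  rw [sliceDx_eq_fderiv hd, sliceDu_eq_fderiv hd, ← smul_eq_mul, ← map_smul, ← map_add]
  simp

theorem iteratedDeriv_mul_sub_pow_eq_zero {u w : ℝ → ℝ} {x : ℝ} (hu : AnalyticAt ℝ u x)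
    (hw : AnalyticAt ℝ w x) {n k : ℕ} (hnk : n < k) :
    iteratedDeriv n (fun y => w y * (u y - u x) ^ k) x = 0 := by
  induction n generalizing k w with
  | zero => simp [(Nat.pos_iff_ne_zero.1 hnk)]
  | succ n ih =>
    obtain ⟨k, rfl⟩ : ∃ j, k = j + 1 := ⟨k - 1, by omega⟩
    have e : deriv (fun y => w y * (u y - u x) ^ (k + 1)) =ᶠ[𝓝 x] fun y =>
        deriv w y * (u y - u x) ^ (k + 1) + w y * (k + 1) * deriv u y * (u y - u x) ^ k := by
      filter_upwards [hu.eventually_analyticAt, hw.eventually_analyticAt] with y hy hwy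
      have h1 := hwy.differentiableAt.hasDerivAt.mul
        ((hy.differentiableAt.hasDerivAt.sub_const (u x)).pow (k + 1))
      refine h1.deriv.trans ?_
      simp only [Nat.add_sub_cancel, Pi.pow_apply]
      push_cast
      ring
    have hw' := hw.deriv
    have hu' := hu.deriv
    rw [iteratedDeriv_succ', e.iteratedDeriv_eq, iteratedDeriv_fun_add, ih hw' (by omega),
      ih (w := fun y => w y * (k + 1) * deriv u y) (by fun_prop) (by omega), add_zero]
    · exact AnalyticAt.contDiffAt (by fun_prop)
    · exact AnalyticAt.contDiffAt (by fun_prop)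

/-- The Taylor expansion of `g` in its second variable around `U = u x` computes the derivatives of
`y ↦ g (y, u y)` at `x`, since the `k`-th power of `u y - U` vanishes to order `k` there. The
weight `w` is what makes the induction on the order of the derivative go through. -/
theorem iteratedDeriv_mul_graph {u : ℝ → ℝ} {x : ℝ} (hu : AnalyticAt ℝ u x) (n : ℕ) :
    ∀ {w : ℝ → ℝ} {g : ℝ × ℝ → ℝ}, AnalyticAt ℝ w x → AnalyticAt ℝ g (x, u x) →
    iteratedDeriv n (fun y => w y * g (y, u y)) x = ∑ k ∈ Finset.range (n + 1),
      (k.factorial : ℝ)⁻¹ *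
        iteratedDeriv n (fun y => w y * (u y - u x) ^ k * uDeriv k g (u x) y) x := by
  induction n with
  | zero => intro w g _ _; simp [uDeriv]
  | succ n ih =>
    intro w g hw hg
    have hw' := hw.deriv
    have hu' := hu.deriv
    have hH := fun k => analyticAt_uDeriv hg k
    have hH' := fun k => (analyticAt_uDeriv hg k).deriv
    have hgr := hg.graph hu
    have hgx := hg.sliceDx.graph hu
    have hgu := hg.sliceDu.graph hu
    have hmem : ∀ᶠ y in 𝓝 x, AnalyticAt ℝ g (y, u y) :=
      (continuousAt_id.prodMk hu.continuousAt).eventually hg.eventually_analyticAt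
    have e1 : deriv (fun y => w y * g (y, u y)) =ᶠ[𝓝 x] fun y =>
        deriv w y * g (y, u y) + w y * sliceDx g (y, u y) +
          (w y * deriv u y) * sliceDu g (y, u y) := by
      filter_upwards [hu.eventually_analyticAt, hw.eventually_analyticAt, hmem] with y hy hwy hgy
      refine (hwy.differentiableAt.hasDerivAt.mul (hasDerivAt_graph hgy hy)).deriv.trans ?_
      ring
    -- the three terms of the product rule, for the summand with index `k`
    set P : ℕ → ℝ := fun k => iteratedDeriv n
      (fun y => deriv w y * (u y - u x) ^ k * uDeriv k g (u x) y) x with hP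
    set Q : ℕ → ℝ := fun k => iteratedDeriv n
      (fun y => w y * (u y - u x) ^ k * deriv (uDeriv k g (u x)) y) x with hQ
    set S : ℕ → ℝ := fun k => iteratedDeriv n
      (fun y => w y * deriv u y * (u y - u x) ^ k * uDeriv (k + 1) g (u x) y) x with hS
    have hL : iteratedDeriv (n + 1) (fun y => w y * g (y, u y)) x =
        ∑ k ∈ Finset.range (n + 1), (k.factorial : ℝ)⁻¹ * (P k + Q k + S k) := by
      rw [iteratedDeriv_succ', e1.iteratedDeriv_eq, iteratedDeriv_fun_add, iteratedDeriv_fun_add,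
        ih hw' hg, ih hw hg.sliceDx, ih (w := fun y => w y * deriv u y) (by fun_prop) hg.sliceDu,
        ← Finset.sum_add_distrib, ← Finset.sum_add_distrib]
      · refine Finset.sum_congr rfl fun k _ => ?_
        have e2 : (fun y => w y * (u y - u x) ^ k * uDeriv k (sliceDx g) (u x) y) =ᶠ[𝓝 x]
            fun y => w y * (u y - u x) ^ k * deriv (uDeriv k g (u x)) y :=
          (deriv_uDeriv hg k).mono fun y hy => by simp only [hy]
        rw [e2.iteratedDeriv_eq, ← uDeriv_succ]
        simp only [hP, hQ, hS]
        ring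
      all_goals exact AnalyticAt.contDiffAt (by fun_prop)
    have hR : ∀ k, iteratedDeriv (n + 1)
        (fun y => w y * (u y - u x) ^ (k + 1) * uDeriv (k + 1) g (u x) y) x =
        P (k + 1) + Q (k + 1) + (k + 1) * S k := by
      intro k
      have hk := hH (k + 1)
      have hk' := hH' (k + 1)
      have e3 : deriv (fun y => w y * (u y - u x) ^ (k + 1) * uDeriv (k + 1) g (u x) y) =ᶠ[𝓝 x]
          fun y => deriv w y * (u y - u x) ^ (k + 1) * uDeriv (k + 1) g (u x) y +
            w y * (u y - u x) ^ (k + 1) * deriv (uDeriv (k + 1) g (u x)) y +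
            (k + 1) * (w y * deriv u y * (u y - u x) ^ k * uDeriv (k + 1) g (u x) y) := by
        filter_upwards [hu.eventually_analyticAt, hw.eventually_analyticAt,
          hk.eventually_analyticAt] with y hy hwy hky
        have h1 := (hwy.differentiableAt.hasDerivAt.mul
          ((hy.differentiableAt.hasDerivAt.sub_const (u x)).pow (k + 1))).mul
          hky.differentiableAt.hasDerivAt
        refine h1.deriv.trans ?_
        simp only [Nat.add_sub_cancel, Pi.pow_apply, Pi.mul_apply]
        push_cast
        ring
      rw [iteratedDeriv_succ', e3.iteratedDeriv_eq, iteratedDeriv_fun_add, iteratedDeriv_fun_add,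
        iteratedDeriv_const_mul_field]
      all_goals exact AnalyticAt.contDiffAt (by fun_prop)
    have hR0 : iteratedDeriv (n + 1)
        (fun y => w y * (u y - u x) ^ 0 * uDeriv 0 g (u x) y) x = P 0 + Q 0 := by
      have hk := hH 0
      have hk' := hH' 0
      have e3 : deriv (fun y => w y * (u y - u x) ^ 0 * uDeriv 0 g (u x) y) =ᶠ[𝓝 x]
          fun y => deriv w y * (u y - u x) ^ 0 * uDeriv 0 g (u x) y +
            w y * (u y - u x) ^ 0 * deriv (uDeriv 0 g (u x)) y := by
        filter_upwards [hw.eventually_analyticAt, hk.eventually_analyticAt] with y hwy hky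
        simp only [pow_zero, mul_one]
        exact (hwy.differentiableAt.hasDerivAt.mul hky.differentiableAt.hasDerivAt).deriv
      rw [iteratedDeriv_succ', e3.iteratedDeriv_eq, iteratedDeriv_fun_add]
      all_goals exact AnalyticAt.contDiffAt (by fun_prop)
    have hP0 : P (n + 1) = 0 := by
      have := iteratedDeriv_mul_sub_pow_eq_zero hu (hw'.mul (hH (n + 1))) (Nat.lt_add_one n)
      rw [← this]
      simp only [hP]
      congr 1
      funext y
      simp only [Pi.mul_apply]
      ring
    have hQ0 : Q (n + 1) = 0 := by
      have := iteratedDeriv_mul_sub_pow_eq_zero hu (hw.mul (hH' (n + 1))) (Nat.lt_add_one n)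
      rw [← this]
      simp only [hQ]
      congr 1
      funext y
      simp only [Pi.mul_apply]
      ring
    rw [hL, Finset.sum_range_succ' _ (n + 1), hR0]
    simp only [hR]
    have hfac : ∀ k : ℕ, ((k + 1).factorial : ℝ)⁻¹ * (k + 1) = (k.factorial : ℝ)⁻¹ := fun k => by
      have : (k.factorial : ℝ) ≠ 0 := by positivity
      have : (k : ℝ) + 1 ≠ 0 := by positivity
      rw [Nat.factorial_succ]
      push_cast
      field_simp
    have hsum : ∑ k ∈ Finset.range (n + 1), ((k + 1).factorial : ℝ)⁻¹ * (P (k + 1) + Q (k + 1)) +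
        ((0 : ℕ).factorial : ℝ)⁻¹ * (P 0 + Q 0) =
        ∑ k ∈ Finset.range (n + 1), (k.factorial : ℝ)⁻¹ * (P k + Q k) := by
      rw [← Finset.sum_range_succ' (fun k : ℕ => (k.factorial : ℝ)⁻¹ * (P k + Q k)),
        Finset.sum_range_succ, hP0, hQ0, add_zero, mul_zero, add_zero]
    have hsplit : ∀ k : ℕ, ((k + 1).factorial : ℝ)⁻¹ * (P (k + 1) + Q (k + 1) + (k + 1) * S k) =
        ((k + 1).factorial : ℝ)⁻¹ * (P (k + 1) + Q (k + 1)) + (k.factorial : ℝ)⁻¹ * S k :=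
      fun k => by rw [mul_add, ← mul_assoc, hfac]
    simp only [hsplit, Finset.sum_add_distrib]
    rw [add_right_comm, hsum, ← Finset.sum_add_distrib]
    exact Finset.sum_congr rfl fun k _ => by ring

theorem iteratedDeriv_sub_pow {u : ℝ → ℝ} {x : ℝ} (hu : AnalyticAt ℝ u x) (c : ℝ) (m k : ℕ) :
    iteratedDeriv m (fun y => (u y - c) ^ k) x = ∑ r ∈ Finset.range (k + 1),
      (k.choose r : ℝ) * (-c) ^ r * iteratedDeriv m (fun y => u y ^ (k - r)) x := by
  have e : (fun y => (u y - c) ^ k) = fun y => ∑ r ∈ Finset.range (k + 1),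
      (k.choose r : ℝ) * (-c) ^ r * u y ^ (k - r) := by
    funext y
    rw [sub_eq_add_neg, add_comm, add_pow]
    exact Finset.sum_congr rfl fun r _ => by ring
  rw [e, iteratedDeriv_fun_sum]
  · exact Finset.sum_congr rfl fun r _ => iteratedDeriv_const_mul_field _ _
  · intro r _
    exact AnalyticAt.contDiffAt (by fun_prop)

/-- The chain rule for the `n`-th derivative of `y ↦ g (y, u y)`. -/
theorem iteratedDeriv_graph {u : ℝ → ℝ} {x : ℝ} (hu : AnalyticAt ℝ u x) {g : ℝ × ℝ → ℝ}
    (hg : AnalyticAt ℝ g (x, u x)) (n : ℕ) :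
    iteratedDeriv n (fun y => g (y, u y)) x =
      ∑ m ∈ Finset.range (n + 1), ∑ k ∈ Finset.range (m + 1),
        (n.choose m : ℝ) * (k.factorial : ℝ)⁻¹ * iteratedDeriv m (fun y => (u y - u x) ^ k) x *
          pderiv (n - m) k g x (u x) := by
  have h := iteratedDeriv_mul_graph hu n (w := fun _ => 1) analyticAt_const hg
  simp only [one_mul] at h
  have h2 : ∀ k : ℕ, iteratedDeriv n (fun y => (u y - u x) ^ k * uDeriv k g (u x) y) x =
      ∑ m ∈ Finset.range (n + 1), (n.choose m : ℝ) *
        iteratedDeriv m (fun y => (u y - u x) ^ k) x * pderiv (n - m) k g x (u x) := fun k => by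
    have hk := analyticAt_uDeriv hg k
    rw [iteratedDeriv_fun_mul (AnalyticAt.contDiffAt (by fun_prop)) hk.contDiffAt]
    rfl
  rw [h]
  simp only [h2, Finset.mul_sum]
  rw [Finset.sum_comm]
  refine Finset.sum_congr rfl fun m hm => ?_
  have hsub : Finset.range (m + 1) ⊆ Finset.range (n + 1) :=
    Finset.range_mono (Nat.succ_le_of_lt (Finset.mem_range.1 hm))
  rw [← Finset.sum_subset hsub]
  · exact Finset.sum_congr rfl fun k _ => by ring
  · intro k _ hk
    have hlt : m < k := by
      rw [Finset.mem_range] at hk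
      omega
    have h0 := iteratedDeriv_mul_sub_pow_eq_zero hu (w := fun _ => 1) analyticAt_const hlt
    simp only [one_mul] at h0
    rw [h0]
    ring

/-! ### Total derivatives along the jet of a function -/

/-- The first `N` jet coordinates, together with `x`. -/
def Jet.trunc (N : ℕ) (z : Jet) : ℝ × (Fin N → ℝ) := (z.1, fun i => z.2 i)

/-- Near `z`, for the product topology, `G` is an analytic function of finitely many jet
coordinates. -/
def JetAnalyticAt (G : Jet → ℝ) (z : Jet) : Prop :=
  ∃ (N : ℕ) (g : ℝ × (Fin N → ℝ) → ℝ), AnalyticAt ℝ g (z.trunc N) ∧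
    G =ᶠ[𝓝 z] fun w => g (w.trunc N)

theorem Jet.continuous_trunc (N : ℕ) : Continuous (Jet.trunc N) := by
  unfold Jet.trunc
  fun_prop

theorem Filter.EventuallyEq.totalDeriv_eq {G H : Jet → ℝ} {z : Jet} (h : G =ᶠ[𝓝 z] H) :
    totalDeriv G z = totalDeriv H z := by
  have h1 : jetDx G z = jetDx H z := by
    refine EventuallyEq.deriv_eq ?_
    have hc : Continuous fun s : ℝ => ((s, z.2) : Jet) := by fun_prop
    exact (hc.continuousAt (x := z.1)).eventually h
  have h2 : ∀ k, jetDu k G z = jetDu k H z := fun k => by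
    refine EventuallyEq.deriv_eq ?_
    have hc : Continuous fun s : ℝ => ((z.1, Function.update z.2 k s) : Jet) :=
      continuous_const.prodMk (continuous_const.update k continuous_id)
    have hz : ((z.1, Function.update z.2 k (z.2 k)) : Jet) = z := by
      rw [Function.update_eq_self]
    have h' : G =ᶠ[𝓝 (z.1, Function.update z.2 k (z.2 k))] H := by rwa [hz]
    exact (hc.continuousAt (x := z.2 k)).eventually h'
  simp only [totalDeriv, h1, h2]

/-- On functions of finitely many jet coordinates the total derivative is the derivative in the
direction `(1, u₁, u₂, …)`. -/
theorem totalDeriv_comp_trunc {N : ℕ} {g : ℝ × (Fin N → ℝ) → ℝ} {z : Jet}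
    (hg : DifferentiableAt ℝ g (z.trunc N)) :
    totalDeriv (fun w => g (w.trunc N)) z =
      fderiv ℝ g (z.trunc N) (1, fun i => z.2 (i + 1)) := by
  have h1 : jetDx (fun w => g (w.trunc N)) z = fderiv ℝ g (z.trunc N) (1, 0) :=
    (hg.hasFDerivAt.comp_hasDerivAt z.1
      ((hasDerivAt_id z.1).prodMk (hasDerivAt_const z.1 fun i : Fin N => z.2 i))).deriv
  have h2 : ∀ i : Fin N, jetDu i (fun w => g (w.trunc N)) z =
      fderiv ℝ g (z.trunc N) (0, Pi.single i 1) := fun i => by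
    have hup : ∀ s : ℝ, Jet.trunc N (z.1, Function.update z.2 i s) =
        (z.1, Function.update (fun j : Fin N => z.2 j) i s) := fun s => by
      refine Prod.ext rfl ?_
      funext j
      simp [Jet.trunc, Function.update_apply, Fin.ext_iff]
    have hz : z.trunc N = (z.1, Function.update (fun j : Fin N => z.2 j) i (z.2 i)) := by
      rw [Function.update_eq_self i fun j : Fin N => z.2 j]
      rfl
    have hd : HasDerivAt (fun s : ℝ => (z.1, Function.update (fun j : Fin N => z.2 j) i s))
        (0, Pi.single i 1) (z.2 i) :=
      (hasDerivAt_const _ _).prodMk (hasDerivAt_update _ i _)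
    have hg' := hg.hasFDerivAt
    rw [hz] at hg'
    rw [hz]
    simp only [jetDu, hup]
    exact (hg'.comp_hasDerivAt (z.2 i) hd).deriv
  have h3 : ∀ k, N ≤ k → jetDu k (fun w => g (w.trunc N)) z = 0 := fun k hk => by
    have hup : ∀ s : ℝ, Jet.trunc N (z.1, Function.update z.2 k s) = z.trunc N := fun s => by
      refine Prod.ext rfl ?_
      funext j
      have : (j : ℕ) ≠ k := by omega
      simp [Jet.trunc, this]
    simp [jetDu, hup]
  have h4 : ∑ᶠ k : ℕ, z.2 (k + 1) * jetDu k (fun w => g (w.trunc N)) z =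
      ∑ i : Fin N, z.2 (i + 1) * fderiv ℝ g (z.trunc N) (0, Pi.single i 1) := by
    rw [finsum_eq_sum_of_support_subset (s := Finset.range N), Finset.sum_range]
    · simp only [h2]
    · intro k hk
      by_contra hk'
      have : N ≤ k := by simpa using hk'
      exact hk (by simp [h3 k this])
  have h5 : ((1, fun i => z.2 (i + 1)) : ℝ × (Fin N → ℝ)) =
      (1, 0) + ∑ i : Fin N, z.2 (i + 1) • ((0, Pi.single i 1) : ℝ × (Fin N → ℝ)) := by
    refine Prod.ext ?_ ?_
    · simp [Prod.fst_sum]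
    · funext j
      simp [Prod.snd_sum, Finset.sum_apply, Pi.single_apply]
  rw [totalDeriv, h1, h4, h5, map_add, map_sum]
  simp only [map_smul, smul_eq_mul]

namespace JetAnalyticAt

variable {G : Jet → ℝ} {z : Jet}

theorem eventually (h : JetAnalyticAt G z) : ∀ᶠ w in 𝓝 z, JetAnalyticAt G w := by
  obtain ⟨N, g, hg, hG⟩ := h
  filter_upwards [(Jet.continuous_trunc N).continuousAt.eventually hg.eventually_analyticAt,
    hG.eventually_nhds] with w hw hGw
  exact ⟨N, g, hw, hGw⟩

theorem totalDeriv (h : JetAnalyticAt G z) : JetAnalyticAt (totalDeriv G) z := by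
  obtain ⟨N, g, hg, hG⟩ := h
  -- the last `N` of the first `N + 1` coordinates form the direction of the derivative
  let π : ℝ × (Fin (N + 1) → ℝ) →L[ℝ] ℝ × (Fin N → ℝ) :=
    (ContinuousLinearMap.fst ℝ _ _).prod
      (ContinuousLinearMap.pi fun i => (ContinuousLinearMap.proj (Fin.castSucc i)).comp
        (ContinuousLinearMap.snd ℝ _ _))
  let σ : ℝ × (Fin (N + 1) → ℝ) →L[ℝ] Fin N → ℝ :=
    ContinuousLinearMap.pi fun i => (ContinuousLinearMap.proj (Fin.succ i)).comp
        (ContinuousLinearMap.snd ℝ _ _)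
  have hπ : ∀ w : Jet, π (w.trunc (N + 1)) = w.trunc N := fun w => rfl
  have hσ : ∀ w : Jet, σ (w.trunc (N + 1)) = fun i : Fin N => w.2 (i + 1) := fun w => rfl
  refine ⟨N + 1, fun v => fderiv ℝ g (π v) (1, σ v), ?_, ?_⟩
  · have h1 : AnalyticAt ℝ (fun v => fderiv ℝ g (π v)) (z.trunc (N + 1)) :=
      AnalyticAt.comp (g := fderiv ℝ g) (f := π) (by rw [hπ]; exact hg.fderiv) (π.analyticAt _)
    have h2 : AnalyticAt ℝ (fun v => ((1, σ v) : ℝ × (Fin N → ℝ))) (z.trunc (N + 1)) :=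
      analyticAt_const.prod (σ.analyticAt _)
    exact ((ContinuousLinearMap.id ℝ (ℝ × (Fin N → ℝ) →L[ℝ] ℝ)).analyticAt_bilinear _).comp
      (h1.prod h2)
  · filter_upwards [(Jet.continuous_trunc N).continuousAt.eventually hg.eventually_analyticAt,
      hG.eventually_nhds] with w hw hGw
    rw [EventuallyEq.totalDeriv_eq hGw, totalDeriv_comp_trunc hw.differentiableAt, hπ, hσ]

end JetAnalyticAt

theorem AnalyticAt.iteratedDeriv_of {u : ℝ → ℝ} {x : ℝ} (hu : AnalyticAt ℝ u x) (k : ℕ) :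
    AnalyticAt ℝ (iteratedDeriv k u) x := by
  rw [iteratedDeriv_eq_iterate]
  exact hu.iterated_deriv k

theorem continuousAt_jetOf {u : ℝ → ℝ} {x : ℝ} (hu : AnalyticAt ℝ u x) :
    ContinuousAt (jetOf u) x :=
  continuousAt_id.prodMk (continuousAt_pi.2 fun k => (hu.iteratedDeriv_of k).continuousAt)

theorem hasDerivAt_comp_jetOf {u : ℝ → ℝ} {x : ℝ} (hu : AnalyticAt ℝ u x) {G : Jet → ℝ}
    (hG : JetAnalyticAt G (jetOf u x)) :
    HasDerivAt (fun y => G (jetOf u y)) (totalDeriv G (jetOf u x)) x := by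
  obtain ⟨N, g, hg, hGg⟩ := hG
  have hd : HasDerivAt (fun y => (jetOf u y).trunc N)
      (1, fun i : Fin N => iteratedDeriv (i + 1) u x) x := by
    refine (hasDerivAt_id x).prodMk (hasDerivAt_pi.2 fun i => ?_)
    have := (hu.iteratedDeriv_of i).differentiableAt.hasDerivAt
    rwa [← iteratedDeriv_succ] at this
  rw [EventuallyEq.totalDeriv_eq hGg, totalDeriv_comp_trunc hg.differentiableAt]
  exact (hg.differentiableAt.hasFDerivAt.comp_hasDerivAt x hd).congr_of_eventuallyEq
    ((continuousAt_jetOf hu).eventually hGg)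

/-- On the jet of `u`, iterated total derivatives are iterated derivatives of the composite
function. -/
theorem totalDeriv_iterate_jetOf {u : ℝ → ℝ} {x : ℝ} (hu : AnalyticAt ℝ u x) (k : ℕ)
    {G : Jet → ℝ} (hG : JetAnalyticAt G (jetOf u x)) :
    (totalDeriv^[k] G) (jetOf u x) = iteratedDeriv k (fun y => G (jetOf u y)) x := by
  induction k generalizing G with
  | zero => simp
  | succ k ih =>
    rw [Function.iterate_succ_apply, ih hG.totalDeriv, iteratedDeriv_succ']
    refine EventuallyEq.iteratedDeriv_eq k ?_
    filter_upwards [hu.eventually_analyticAt,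
      (continuousAt_jetOf hu).eventually hG.eventually] with y hy hGy
    exact (hasDerivAt_comp_jetOf hy hGy).deriv.symm

theorem jetAnalyticAt_onJet {φ : ℝ × ℝ → ℝ} {z : Jet} (hφ : AnalyticAt ℝ φ (z.1, z.2 0)) :
    JetAnalyticAt (onJet φ) z := by
  refine ⟨1, fun v => φ (v.1, v.2 0), ?_, Eventually.of_forall fun w => rfl⟩
  exact AnalyticAt.comp (g := φ) (f := fun v : ℝ × (Fin 1 → ℝ) => (v.1, v.2 0)) hφ
    (analyticAt_fst.prod
      (((ContinuousLinearMap.proj (R := ℝ) (φ := fun _ : Fin 1 => ℝ) 0).comp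
        (ContinuousLinearMap.snd ℝ ℝ (Fin 1 → ℝ))).analyticAt _))

theorem jetAnalyticAt_characteristic {ξ φ : ℝ × ℝ → ℝ} {z : Jet}
    (hξ : AnalyticAt ℝ ξ (z.1, z.2 0)) (hφ : AnalyticAt ℝ φ (z.1, z.2 0)) :
    JetAnalyticAt (fun w => onJet φ w - onJet ξ w * w.2 1) z := by
  refine ⟨2, fun v => φ (v.1, v.2 0) - ξ (v.1, v.2 0) * v.2 1, ?_,
    Eventually.of_forall fun w => rfl⟩
  have hc : ∀ i : Fin 2, AnalyticAt ℝ (fun v : ℝ × (Fin 2 → ℝ) => v.2 i) (z.trunc 2) := fun i =>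
    ((ContinuousLinearMap.proj (R := ℝ) (φ := fun _ : Fin 2 => ℝ) i).comp
        (ContinuousLinearMap.snd ℝ ℝ (Fin 2 → ℝ))).analyticAt _
  have hp : AnalyticAt ℝ (fun v : ℝ × (Fin 2 → ℝ) => (v.1, v.2 0)) (z.trunc 2) :=
    analyticAt_fst.prod (hc 0)
  exact (AnalyticAt.comp (g := φ) (f := fun v : ℝ × (Fin 2 → ℝ) => (v.1, v.2 0)) hφ hp).sub
    ((AnalyticAt.comp (g := ξ) (f := fun v : ℝ × (Fin 2 → ℝ) => (v.1, v.2 0)) hξ hp).mul (hc 1))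

theorem prolongCoeff_jetOf {ξ φ : ℝ × ℝ → ℝ} {u : ℝ → ℝ} {x : ℝ} (hu : AnalyticAt ℝ u x)
    (hξ : AnalyticAt ℝ ξ (x, u x)) (hφ : AnalyticAt ℝ φ (x, u x)) (k : ℕ) :
    prolongCoeff ξ φ k (jetOf u x) = iteratedDeriv k (fun y => φ (y, u y)) x -
      ∑ i ∈ Finset.range (k + 1), (k.choose i : ℝ) * iteratedDeriv i (fun y => ξ (y, u y)) x *
        iteratedDeriv (k - i + 1) u x + ξ (x, u x) * iteratedDeriv (k + 1) u x := by
  have h0 : ∀ y, (jetOf u y).2 0 = u y := fun y => by simp [jetOf]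
  have h1 : ∀ y, (jetOf u y).2 1 = deriv u y := fun y => by simp [jetOf]
  have hφ' : AnalyticAt ℝ φ ((jetOf u x).1, (jetOf u x).2 0) := by rw [h0]; exact hφ
  have hξ' : AnalyticAt ℝ ξ ((jetOf u x).1, (jetOf u x).2 0) := by rw [h0]; exact hξ
  have hξg := hξ.graph hu
  have hφg := hφ.graph hu
  have hu' := hu.deriv
  have e : (fun y => onJet φ (jetOf u y) - onJet ξ (jetOf u y) * (jetOf u y).2 1) =
      fun y => φ (y, u y) - ξ (y, u y) * deriv u y := by
    funext y
    simp only [onJet, h0, h1]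
    rfl
  rw [prolongCoeff, totalDeriv_iterate_jetOf hu k (jetAnalyticAt_characteristic hξ' hφ'), e,
    iteratedDeriv_fun_sub hφg.contDiffAt (AnalyticAt.contDiffAt (by fun_prop)),
    iteratedDeriv_fun_mul hξg.contDiffAt hu'.contDiffAt]
  have h2 : (jetOf u x).2 (k + 1) = iteratedDeriv (k + 1) u x := rfl
  simp only [onJet, h0, h2, iteratedDeriv_succ']
  rfl

theorem totalDeriv_iterate_onJet {φ : ℝ × ℝ → ℝ} {u : ℝ → ℝ} {x : ℝ} (hu : AnalyticAt ℝ u x)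
    (hφ : AnalyticAt ℝ φ (x, u x)) (k : ℕ) :
    (totalDeriv^[k] (onJet φ)) (jetOf u x) = iteratedDeriv k (fun y => φ (y, u y)) x := by
  have h0 : ∀ y, (jetOf u y).2 0 = u y := fun y => by simp [jetOf]
  rw [totalDeriv_iterate_jetOf hu k (jetAnalyticAt_onJet (by rw [h0]; exact hφ))]
  simp only [onJet, h0]
  rfl

/-! ### The prolongation formula -/

/-- Where the series defining `rlJet` converges, it is linear in each jet coordinate `u_k`. -/
theorem hasDerivAt_rlJet_update {a p : ℝ} {z : Jet}
    (hz : Summable fun k : ℕ => rlCoeff a p k z.1 * z.2 k) (k : ℕ) (s₀ : ℝ) :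
    HasDerivAt (fun s => rlJet a p (z.1, Function.update z.2 k s)) (rlCoeff a p k z.1) s₀ := by
  have e : (fun s => rlJet a p (z.1, Function.update z.2 k s)) = fun s =>
      rlCoeff a p k z.1 * s - rlCoeff a p k z.1 * z.2 k +
        ∑' j : ℕ, rlCoeff a p j z.1 * z.2 j := by
    funext s
    have h := hz.hasSum.update k (rlCoeff a p k z.1 * s)
    rw [← h.tsum_eq, rlJet]
    refine tsum_congr fun j => ?_
    rcases eq_or_ne j k with rfl | hj
    · simp
    · simp [hj]
  rw [e]
  simpa using (((hasDerivAt_id s₀).const_mul (rlCoeff a p k z.1)).sub_const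
    (rlCoeff a p k z.1 * z.2 k)).add_const (∑' j : ℕ, rlCoeff a p j z.1 * z.2 j)

theorem jetDu_rlJet {a p : ℝ} {z : Jet}
    (hz : Summable fun k : ℕ => rlCoeff a p k z.1 * z.2 k) (k : ℕ) :
    jetDu k (rlJet a p) z = rlCoeff a p k z.1 :=
  (hasDerivAt_rlJet_update hz k _).deriv

theorem hasDerivAt_rlJet_fst {a p : ℝ} {z : Jet} (haz : a < z.1)
    (hz : TaylorGrowth (z.1 - a) z.2) :
    HasDerivAt (fun s => rlJet a p (s, z.2)) (∑' k : ℕ, rlCoeffDeriv a p k z.1 * z.2 k) z.1 := by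
  have h := hasDerivAt_tsum_rlCoeff_mul haz p (A := fun k _ => z.2 k) (A' := fun _ _ => 0)
    (B := fun k => |z.2 k|) (hz.mono fun k => (abs_abs _).le)
    (Eventually.of_forall fun t k => ⟨hasDerivAt_const _ _, le_rfl, by simp⟩)
  simp only [mul_zero, add_zero] at h
  exact h

theorem hasSum_rlCoeffDeriv_mul {a x : ℝ} (hax : a < x) (p : ℝ) {f : ℝ → ℝ}
    (hf : TaylorReaches a x f) :
    HasSum (fun k : ℕ => rlCoeffDeriv a p k x * iteratedDeriv k f x)
      ((x - a) ^ (-p - 1) / Real.Gamma (-p) * f a) := by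
  refine ((hf.hasSum_taylor hax (left_mem_Icc.2 hax.le)).mul_left
    ((x - a) ^ (-p - 1) / Real.Gamma (-p))).congr_fun fun k => ?_
  rw [rlCoeffDeriv_eq hax]
  ring

/-- The commutator of the operator of order `p` with the derivative is the boundary term at `a`. -/
theorem tsum_rlCoeff_mul_iteratedDeriv_succ {a x : ℝ} (hax : a < x) (p : ℝ) {f : ℝ → ℝ}
    (hf : TaylorReaches a x f) :
    ∑' k : ℕ, rlCoeff a p k x * iteratedDeriv (k + 1) f x =
      RL a (p + 1) f x - (x - a) ^ (-p - 1) / Real.Gamma (-p) * f a := by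
  have hg := hf.taylorGrowth hax
  have h1 := hasSum_rlCoeffDeriv_add hax p hg
  have h2 := (hasSum_rlCoeffDeriv_mul hax p hf)
  have h3 := ((hg.shift (sub_pos.2 hax).le).summable_rlCoeff_mul hax p).hasSum
  rw [(hasSum_RL hax (p + 1) hf).tsum_eq] at h1
  have := h1.unique (h2.add h3)
  linarith

/-- The Leibniz rule for the product of a function vanishing at `a` with a derivative. The boundary
terms of the derivative sum up to a multiple of the value of the first factor at `a`. -/
theorem leibniz_deriv {a x : ℝ} (hax : a < x) (p : ℝ) {f g : ℝ → ℝ} (hf : TaylorReaches a x f)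
    (hg : TaylorReaches a x g) (hfa : f a = 0) :
    (Summable fun n : ℕ => binom p (n + 1) * iteratedDeriv (n + 1) f x * RL a (p - n) g x) ∧
    HasSum (fun m : ℕ => rlCoeff a p m x * ∑ i ∈ Finset.range (m + 1),
        (m.choose i : ℝ) * iteratedDeriv i f x * iteratedDeriv (m - i + 1) g x)
      (f x * RL a (p + 1) g x +
        ∑' n : ℕ, binom p (n + 1) * iteratedDeriv (n + 1) f x * RL a (p - n) g x) := by
  have hA := hf.taylorGrowth hax
  have hB := (hg.taylorGrowth hax).shift (sub_pos.2 hax).le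
  have h1 := hA.summable_binom_mul_tsum hax hB p
  have h2 := (hA.hasSum_leibniz hax hB p)
  have h3 := (hasSum_rlCoeffDeriv_mul hax p hf).mul_right (g a)
  rw [hfa, mul_zero, zero_mul] at h3
  have h4 := h1.hasSum.add h3
  rw [add_zero] at h4
  have e : ∀ n : ℕ, binom p n * iteratedDeriv n f x *
        ∑' k : ℕ, rlCoeff a (p - n) k x * iteratedDeriv (k + 1) g x +
      rlCoeffDeriv a p n x * iteratedDeriv n f x * g a =
      binom p n * iteratedDeriv n f x * RL a (p - n + 1) g x := fun n => by
    rw [tsum_rlCoeff_mul_iteratedDeriv_succ hax _ hg]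
    have e1 : -(p - n) = (n : ℝ) - p := by ring
    unfold rlCoeffDeriv
    rw [e1]
    ring
  -- the boundary terms were added with total sum `0`, so the value of the sum is unchanged
  simp only [e] at h4
  have h5 := (summable_nat_add_iff 1).2 h4.summable
  have e2 : ∀ n : ℕ, p - ((n + 1 : ℕ) : ℝ) + 1 = p - n := fun n => by push_cast; ring
  simp only [e2] at h5
  refine ⟨h5, ?_⟩
  rw [← h4.tsum_eq, h4.summable.tsum_eq_zero_add] at h2
  simp only [e2] at h2
  simpa [binom_zero] using h2

/-- The prolongation formula at the jet of a function, together with the existence of everything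
that enters it. -/
theorem prolong_rlJet {a x p : ℝ} (hax : a < x) {ξ φ : ℝ × ℝ → ℝ} {u : ℝ → ℝ}
    (hξ : AnalyticAt ℝ ξ (x, u x)) (hφ : AnalyticAt ℝ φ (x, u x))
    (hξa : ξ (a, u a) = 0) (hu : TaylorReaches a x u)
    (hξu : TaylorReaches a x fun y => ξ (y, u y)) (hφu : TaylorReaches a x fun y => φ (y, u y)) :
    ProlongDefined ξ φ (rlJet a p) (jetOf u x) ∧
    (Summable fun n : ℕ =>
      binom p (n + 1) * iteratedDeriv (n + 1) (fun y => ξ (y, u y)) x * RL a (p - n) u x) ∧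
    prolong ξ φ (rlJet a p) (jetOf u x) = RL a p (fun y => φ (y, u y)) x -
      ∑' n : ℕ, binom p (n + 1) * iteratedDeriv (n + 1) (fun y => ξ (y, u y)) x *
        RL a (p - n) u x := by
  have hua := hu.analyticAt hax
  have hz : TaylorGrowth ((jetOf u x).1 - a) (jetOf u x).2 := hu.taylorGrowth hax
  have hzs : Summable fun k : ℕ => rlCoeff a p k (jetOf u x).1 * (jetOf u x).2 k :=
    hz.summable_rlCoeff_mul hax p
  obtain ⟨hs, hL⟩ := leibniz_deriv hax p hξu hu hξa
  have hsh := ((hz.shift (sub_pos.2 hax).le).summable_rlCoeff_mul hax p).hasSum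
  have hsum := ((hasSum_RL hax p hφu).sub hL).add (hsh.mul_left (ξ (x, u x)))
  have hcoef : ∀ k : ℕ, prolongCoeff ξ φ k (jetOf u x) * jetDu k (rlJet a p) (jetOf u x) =
      rlCoeff a p k x * iteratedDeriv k (fun y => φ (y, u y)) x -
        rlCoeff a p k x * ∑ i ∈ Finset.range (k + 1), (k.choose i : ℝ) *
          iteratedDeriv i (fun y => ξ (y, u y)) x * iteratedDeriv (k - i + 1) u x +
        ξ (x, u x) * (rlCoeff a p k x * iteratedDeriv (k + 1) u x) := fun k => by
    have h1 : jetDu k (rlJet a p) (jetOf u x) = rlCoeff a p k x := jetDu_rlJet hzs k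
    rw [prolongCoeff_jetOf hua hξ hφ, h1]
    ring
  have hsum' : HasSum (fun k : ℕ =>
      prolongCoeff ξ φ k (jetOf u x) * jetDu k (rlJet a p) (jetOf u x)) _ :=
    hsum.congr_fun hcoef
  have hx := hasDerivAt_rlJet_fst (p := p) (z := jetOf u x) hax hz
  have hξx : onJet ξ (jetOf u x) = ξ (x, u x) := by simp [onJet, jetOf]
  have hdx : jetDx (rlJet a p) (jetOf u x) =
      ∑' k : ℕ, rlCoeffDeriv a p k x * iteratedDeriv k u x := hx.deriv
  refine ⟨⟨hx.differentiableAt, fun k => (hasDerivAt_rlJet_update hzs k _).differentiableAt,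
    hsum'.summable⟩, hs, ?_⟩
  have hcomm := tsum_rlCoeff_mul_iteratedDeriv_succ hax p hu
  have hbd := (hasSum_rlCoeffDeriv_mul hax p hu).tsum_eq
  have hsh' : ∑' k : ℕ, rlCoeff a p k x * (jetOf u x).2 (k + 1) =
    ∑' k : ℕ, rlCoeff a p k x * iteratedDeriv (k + 1) u x := rfl
  rw [prolong, hsum'.tsum_eq, hξx, hdx, hsh', hcomm, hbd]
  ring

/-! ### Osler's chain rule -/

theorem oslerTerm_eq (p : ℝ) (φ : ℝ × ℝ → ℝ) (u : ℝ → ℝ) (x : ℝ) (n m k r : ℕ) :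
    oslerTerm p φ u x n m k r =
      rlCoeff 0 p n x * ((n.choose m : ℝ) * (k.factorial : ℝ)⁻¹ *
        ((k.choose r : ℝ) * (-u x) ^ r * iteratedDeriv m (fun y => u y ^ (k - r)) x) *
        pderiv (n - m) k φ x (u x)) := by
  have e : (n : ℝ) + 1 - p = n - p + 1 := by ring
  simp only [oslerTerm, rlCoeff, sub_zero, e, div_eq_mul_inv, mul_inv]
  ring

/-- The sum over `r` is the binomial expansion of `(u y - u x) ^ k`. -/
theorem sum_oslerTerm (p : ℝ) (φ : ℝ × ℝ → ℝ) {u : ℝ → ℝ} {x : ℝ} (hu : AnalyticAt ℝ u x)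
    (n m k : ℕ) :
    ∑ r ∈ Finset.range (k + 1), oslerTerm p φ u x n m k r =
      rlCoeff 0 p n x * ((n.choose m : ℝ) * (k.factorial : ℝ)⁻¹ *
        iteratedDeriv m (fun y => (u y - u x) ^ k) x * pderiv (n - m) k φ x (u x)) := by
  simp only [oslerTerm_eq]
  rw [← Finset.mul_sum, iteratedDeriv_sub_pow hu]
  congr 1
  rw [Finset.mul_sum, Finset.sum_mul]

theorem sum_sum_sum_oslerTerm (p : ℝ) {φ : ℝ × ℝ → ℝ} {u : ℝ → ℝ} {x : ℝ}
    (hu : AnalyticAt ℝ u x) (hφ : AnalyticAt ℝ φ (x, u x)) (n : ℕ) :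
    ∑ m ∈ Finset.range (n + 1), ∑ k ∈ Finset.range (m + 1),
        ∑ r ∈ Finset.range (k + 1), oslerTerm p φ u x n m k r =
      rlCoeff 0 p n x * iteratedDeriv n (fun y => φ (y, u y)) x := by
  simp only [sum_oslerTerm p φ hu]
  rw [iteratedDeriv_graph hu hφ, Finset.mul_sum]
  exact Finset.sum_congr rfl fun m _ => by rw [Finset.mul_sum]

theorem iteratedDeriv_sub_pow_zero (u : ℝ → ℝ) (c x : ℝ) {m : ℕ} (hm : 0 < m) :
    iteratedDeriv m (fun y => (u y - c) ^ 0) x = 0 := by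
  simp [iteratedDeriv_const, hm.ne']

theorem iteratedDeriv_sub_pow_one {u : ℝ → ℝ} {x : ℝ} (c : ℝ) {m : ℕ} (hm : 0 < m) :
    iteratedDeriv m (fun y => (u y - c) ^ 1) x = iteratedDeriv m u x := by
  obtain ⟨j, rfl⟩ : ∃ j, m = j + 1 := ⟨m - 1, by omega⟩
  simp only [pow_one, iteratedDeriv_succ']
  congr 1
  funext y
  simp

/-- The terms of degree at most one in the Taylor expansion of `φ` in `u` account for everything
but `muTerm`. -/
theorem rlCoeff_mul_iteratedDeriv_graph (p : ℝ) {φ : ℝ × ℝ → ℝ} {u : ℝ → ℝ} {x : ℝ}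
    (hu : AnalyticAt ℝ u x) (hφ : AnalyticAt ℝ φ (x, u x)) (n : ℕ) :
    rlCoeff 0 p n x * iteratedDeriv n (fun y => φ (y, u y)) x =
      rlCoeff 0 p n x * pderiv n 0 φ x (u x)
        + rlCoeff 0 p n x * ∑ m ∈ Finset.range (n + 1),
          (n.choose m : ℝ) * iteratedDeriv m u x * pderiv (n - m) 1 φ x (u x)
        - u x * (rlCoeff 0 p n x * pderiv n 1 φ x (u x))
        + muTerm p φ u x n := by
  set R : ℕ → ℕ → ℝ := fun m k => rlCoeff 0 p n x * ((n.choose m : ℝ) * (k.factorial : ℝ)⁻¹ *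
    iteratedDeriv m (fun y => (u y - u x) ^ k) x * pderiv (n - m) k φ x (u x)) with hR
  have hmu : muTerm p φ u x n = ∑ m ∈ Finset.Icc 2 n, ∑ k ∈ Finset.Icc 2 m, R m k := by
    refine Finset.sum_congr rfl fun m hm => Finset.sum_congr rfl fun k hk => ?_
    have hm2 : m ≠ 0 := by
      have := (Finset.mem_Icc.1 hm).1
      omega
    have h := sum_oslerTerm p φ hu n m k
    rw [Finset.sum_range_succ] at h
    have h0 : oslerTerm p φ u x n m k k = 0 := by
      simp [oslerTerm, iteratedDeriv_const, hm2]
    rw [h0, add_zero] at h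
    exact h
  have hrow : ∀ m ∈ Finset.Ico 1 (n + 1), ∑ k ∈ Finset.range (m + 1), R m k =
      rlCoeff 0 p n x * ((n.choose m : ℝ) * iteratedDeriv m u x * pderiv (n - m) 1 φ x (u x)) +
        ∑ k ∈ Finset.Icc 2 m, R m k := by
    intro m hm
    have hm1 : 0 < m := (Finset.mem_Ico.1 hm).1
    have hIcc : Finset.Icc 2 m = Finset.Ico 2 (m + 1) := rfl
    rw [Finset.range_eq_Ico, Finset.sum_eq_sum_Ico_succ_bot (by omega),
      Finset.sum_eq_sum_Ico_succ_bot (by omega), hIcc]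
    simp only [hR]
    rw [iteratedDeriv_sub_pow_zero _ _ _ hm1, zero_add, iteratedDeriv_sub_pow_one _ hm1]
    simp
  have htot : rlCoeff 0 p n x * iteratedDeriv n (fun y => φ (y, u y)) x =
      ∑ m ∈ Finset.range (n + 1), ∑ k ∈ Finset.range (m + 1), R m k := by
    rw [iteratedDeriv_graph hu hφ, Finset.mul_sum]
    exact Finset.sum_congr rfl fun m _ => by rw [Finset.mul_sum]
  have hsub : ∑ m ∈ Finset.Icc 2 n, ∑ k ∈ Finset.Icc 2 m, R m k =
      ∑ m ∈ Finset.Ico 1 (n + 1), ∑ k ∈ Finset.Icc 2 m, R m k := by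
    refine Finset.sum_subset (fun m hm => ?_) fun m hm hm' => ?_
    · simp only [Finset.mem_Icc, Finset.mem_Ico] at hm ⊢
      omega
    · have : m < 2 := by
        simp only [Finset.mem_Icc, Finset.mem_Ico] at hm hm'
        omega
      rw [Finset.Icc_eq_empty (by omega), Finset.sum_empty]
  have hR0 : ∑ k ∈ Finset.range (0 + 1), R 0 k = rlCoeff 0 p n x * pderiv n 0 φ x (u x) := by
    simp [hR]
  have hsplit : ∀ f : ℕ → ℝ,
      ∑ m ∈ Finset.range (n + 1), f m = f 0 + ∑ m ∈ Finset.Ico 1 (n + 1), f m := fun f => by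
    rw [Finset.range_eq_Ico, Finset.sum_eq_sum_Ico_succ_bot (Nat.succ_pos n)]
  clear_value R
  rw [htot, hsplit, hsplit fun m =>
      (n.choose m : ℝ) * iteratedDeriv m u x * pderiv (n - m) 1 φ x (u x),
    Finset.sum_congr rfl hrow, Finset.sum_add_distrib, ← hsub, ← hmu, ← Finset.mul_sum, hR0]
  simp only [Nat.choose_zero_right, Nat.cast_one, iteratedDeriv_zero, Nat.sub_zero]
  ring

theorem pderiv_zero_right (φ : ℝ × ℝ → ℝ) (n : ℕ) (x v : ℝ) :
    pderiv n 0 φ x v = iteratedDeriv n (fun y => φ (y, v)) x := by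
  simp [pderiv]

theorem pderiv_one_right (φ : ℝ × ℝ → ℝ) (n : ℕ) (x v : ℝ) :
    pderiv n 1 φ x v = iteratedDeriv n (fun y => deriv (fun w => φ (y, w)) v) x := by
  simp [pderiv]

/-- The operator applied to `φ (y, u y)`, with the part linear in `u` and its derivatives
isolated. -/
theorem RL_graph_eq {x p : ℝ} (hx : 0 < x) {φ : ℝ × ℝ → ℝ} {u : ℝ → ℝ}
    (hφ : AnalyticAt ℝ φ (x, u x)) (hu : TaylorReaches 0 x u)
    (hφu : TaylorReaches 0 x fun y => φ (y, u y))
    (hφ0 : TaylorReaches 0 x fun y => φ (y, u x))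
    (hφ1 : TaylorReaches 0 x fun y => deriv (fun w => φ (y, w)) (u x)) :
    Summable (muTerm p φ u x) ∧
    (Summable fun n : ℕ =>
      binom p (n + 1) * pderiv (n + 1) 1 φ x (u x) * RL 0 (p - (n + 1)) u x) ∧
    RL 0 p (fun y => φ (y, u y)) x =
      RL 0 p (fun y => φ (y, u x)) x
        - u x * RL 0 p (fun y => deriv (fun w => φ (y, w)) (u x)) x
        + deriv (fun w => φ (x, w)) (u x) * RL 0 p u x
        + ∑' n : ℕ, binom p (n + 1) * pderiv (n + 1) 1 φ x (u x) * RL 0 (p - (n + 1)) u x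
        + mu p φ u x := by
  have hA := hφ1.taylorGrowth hx
  have hB := hu.taylorGrowth hx
  have h1 := hA.summable_binom_mul_tsum hx hB p
  have h2 := hA.hasSum_leibniz hx hB p
  have eRL : ∀ q : ℝ, ∑' k : ℕ, rlCoeff 0 q k x * iteratedDeriv k u x = RL 0 q u x :=
    fun q => (hasSum_RL hx q hu).tsum_eq
  simp only [eRL] at h1 h2
  -- the Leibniz sum with the roles of the two factors exchanged
  have eL : ∀ n : ℕ, ∑ m ∈ Finset.range (n + 1),
        (n.choose m : ℝ) * iteratedDeriv m (fun y => deriv (fun w => φ (y, w)) (u x)) x *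
          iteratedDeriv (n - m) u x =
      ∑ m ∈ Finset.range (n + 1),
        (n.choose m : ℝ) * iteratedDeriv m u x * pderiv (n - m) 1 φ x (u x) := fun n => by
    rw [← Finset.sum_range_reflect]
    refine Finset.sum_congr rfl fun m hm => ?_
    have hm' : m ≤ n := Finset.mem_range_succ_iff.1 hm
    have e1 : n + 1 - 1 - m = n - m := by omega
    have e2 : n - (n - m) = m := by omega
    rw [e1, e2, Nat.choose_symm hm', pderiv_one_right]
    ring
  simp only [eL] at h2
  have h3 := hasSum_RL hx p hφ0
  have h4 := (hasSum_RL hx p hφ1).mul_left (u x)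
  have h5 := hasSum_RL hx p hφu
  have hmu := ((h5.sub h3).sub h2).add h4
  have hmu' : HasSum (muTerm p φ u x) _ := hmu.congr_fun fun n => by
    have := rlCoeff_mul_iteratedDeriv_graph p (hu.analyticAt hx) hφ n
    rw [pderiv_zero_right, pderiv_one_right] at this
    rw [this]
    ring
  have h6 := (summable_nat_add_iff 1).2 h1
  have e3 : ∀ n : ℕ, binom p (n + 1) *
        iteratedDeriv (n + 1) (fun y => deriv (fun w => φ (y, w)) (u x)) x *
          RL 0 (p - ((n + 1 : ℕ) : ℝ)) u x =
      binom p (n + 1) * pderiv (n + 1) 1 φ x (u x) * RL 0 (p - (n + 1)) u x := fun n => by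
    rw [pderiv_one_right]
    push_cast
    rfl
  simp only [e3] at h6
  refine ⟨hmu'.summable, h6, ?_⟩
  rw [mu, hmu'.tsum_eq, h1.tsum_eq_zero_add]
  simp only [e3]
  simp [binom_zero]
  ring

/-! ### Long Taylor radii close to the lower terminal -/

/-- The power series of `ψ` at `(a, u a)` is recentred at `(x, u x)`, which loses at most the
distance between the two points from the radius. -/
theorem eventually_taylorReaches_slice {ψ : ℝ × ℝ → ℝ} {u : ℝ → ℝ} {a : ℝ}
    (hψ : AnalyticAt ℝ ψ (a, u a)) (hu : ContinuousAt u a) :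
    ∀ᶠ x in 𝓝[>] a, TaylorReaches a x fun y => ψ (y, u x) := by
  obtain ⟨q, r, hq⟩ := hψ
  have hlim : ContinuousAt
      (fun x : ℝ => ‖((x - a, u x - u a) : ℝ × ℝ)‖ₑ + ENNReal.ofReal (x - a)) a := by
    have h1 : ContinuousAt (fun x : ℝ => ((x - a, u x - u a) : ℝ × ℝ)) a := by fun_prop
    have h2 : ContinuousAt (fun x : ℝ => x - a) a := by fun_prop
    exact h1.enorm.add (ENNReal.continuous_ofReal.continuousAt.comp h2)
  have hev : ∀ᶠ x in 𝓝 a, ‖((x - a, u x - u a) : ℝ × ℝ)‖ₑ + ENNReal.ofReal (x - a) < r := by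
    refine hlim.eventually_lt_const ?_
    simpa [Prod.mk_zero_zero] using hq.r_pos
  filter_upwards [hev.filter_mono nhdsWithin_le_nhds, self_mem_nhdsWithin] with x hx hax
  set v : ℝ × ℝ := (x - a, u x - u a) with hv
  have h1 := hq.changeOrigin (y := v) (lt_of_le_of_lt le_self_add hx)
  have h2 := h1.comp_sub (-((a, u a) + v))
  have h0 : ContinuousLinearMap.inl ℝ ℝ ℝ 0 = (a, u a) + v + -((a, u a) + v) := by simp
  rw [← h0] at h2
  have h3 := h2.compContinuousLinearMap.comp_sub x
  rw [zero_add] at h3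
  have hfun : (fun y => ((fun z => ψ (z - -((a, u a) + v))) ∘ ContinuousLinearMap.inl ℝ ℝ ℝ)
      (y - x)) = fun y => ψ (y, u x) := by
    funext y
    simp [hv]
  have hr : ENNReal.ofReal (x - a) < r - ‖v‖₊ := lt_tsub_iff_left.2 hx
  have hle : r - ‖v‖₊ ≤ (r - ‖v‖₊) / ‖ContinuousLinearMap.inl ℝ ℝ ℝ‖ₑ := by
    have : ‖ContinuousLinearMap.inl ℝ ℝ ℝ‖ₑ ≤ 1 := by
      have := ContinuousLinearMap.norm_inl_le_one ℝ ℝ ℝ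
      rw [← ofReal_norm]
      exact ENNReal.ofReal_le_one.2 this
    simpa using ENNReal.div_le_div_left this (r - ‖v‖₊)
  rw [hfun] at h3
  exact (taylorReaches_iff hax).2
    ⟨_, _, _, x + 1, h3.mono (bot_le.trans_lt hr) hle, hr, by linarith, fun y _ => rfl⟩

theorem eventually_taylorReaches {f : ℝ → ℝ} {a : ℝ} (hf : AnalyticAt ℝ f a) :
    ∀ᶠ x in 𝓝[>] a, TaylorReaches a x f :=
  eventually_taylorReaches_slice (ψ := fun z => f z.1) (u := fun _ => 0)
    (AnalyticAt.comp (g := f) (f := Prod.fst) hf analyticAt_fst) continuousAt_const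

theorem mainTheorem2 (a b p : ℝ) (hab : a < b) (M : Set (ℝ × ℝ)) (ξ φ : ℝ × ℝ → ℝ)
    (hξ : AnalyticOnNhd ℝ ξ M) (hφ : AnalyticOnNhd ℝ φ M)
    (hξa : ∀ v : ℝ, (a, v) ∈ M → ξ (a, v) = 0)
    (u : ℝ → ℝ) (hu : AnalyticOnNhd ℝ u (Ioo a b))
    (hgraph : ∀ y ∈ Ico a b, (y, u y) ∈ M) :
    (∀ x ∈ Ioo a b,
      TaylorReaches a x u →
      TaylorReaches a x (fun y => ξ (y, u y)) →
      TaylorReaches a x (fun y => φ (y, u y)) →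
      -- the jet function `rlJet` represents the Riemann--Liouville derivative of `u`
      (HasSum (fun k : ℕ => rlCoeff a p k x * iteratedDeriv k u x) (RL a p u x) ∧
        rlJet a p (jetOf u x) = RL a p u x) ∧
      -- the fractional total derivative of `φ` is the one of the composite function
      (Summable (fun k : ℕ => rlCoeff a p k x * (totalDeriv^[k] (onJet φ)) (jetOf u x)) ∧
        fracTotalDeriv a p (onJet φ) (jetOf u x) = RL a p (fun y => φ (y, u y)) x) ∧
      -- the prolongation formula
      (ProlongDefined ξ φ (rlJet a p) (jetOf u x) ∧
        Summable (fun n : ℕ =>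
          binom p (n + 1) * iteratedDeriv (n + 1) (fun y => ξ (y, u y)) x * RL a (p - n) u x) ∧
        prolong ξ φ (rlJet a p) (jetOf u x) =
          RL a p (fun y => φ (y, u y)) x -
            ∑' n : ℕ, binom p (n + 1) * iteratedDeriv (n + 1) (fun y => ξ (y, u y)) x *
              RL a (p - n) u x) ∧
      -- the explicit form for `a = 0` and `p > 0`
      (a = 0 → 0 < p →
        TaylorReaches 0 x (fun y => φ (y, u x)) →
        TaylorReaches 0 x (fun y => deriv (fun w => φ (y, w)) (u x)) →
        -- Osler's chain rule
        HasSum (fun n : ℕ => ∑ m ∈ Finset.range (n + 1), ∑ k ∈ Finset.range (m + 1),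
            ∑ r ∈ Finset.range (k + 1), oslerTerm p φ u x n m k r)
          (RL 0 p (fun y => φ (y, u y)) x) ∧
        Summable (muTerm p φ u x) ∧
        -- the terms linear in `u` and its derivatives isolated
        Summable (fun n : ℕ =>
          binom p (n + 1) * pderiv (n + 1) 1 φ x (u x) * RL 0 (p - (n + 1)) u x) ∧
        RL 0 p (fun y => φ (y, u y)) x =
          RL 0 p (fun y => φ (y, u x)) x
            - u x * RL 0 p (fun y => deriv (fun w => φ (y, w)) (u x)) x
            + deriv (fun w => φ (x, w)) (u x) * RL 0 p u x
            + ∑' n : ℕ, binom p (n + 1) * pderiv (n + 1) 1 φ x (u x) * RL 0 (p - (n + 1)) u x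
            + mu p φ u x ∧
        Summable (fun n : ℕ =>
          (binom p (n + 1) * pderiv (n + 1) 1 φ x (u x)
            - binom p (n + 2) * iteratedDeriv (n + 2) (fun y => ξ (y, u y)) x)
            * RL 0 (p - (n + 1)) u x) ∧
        prolong ξ φ (rlJet 0 p) (jetOf u x) =
          RL 0 p (fun y => φ (y, u x)) x
            + RL 0 p u x *
              (deriv (fun w => φ (x, w)) (u x) - p * deriv (fun y => ξ (y, u y)) x)
            - u x * RL 0 p (fun y => deriv (fun w => φ (y, w)) (u x)) x
            + mu p φ u x
            + ∑' n : ℕ, (binom p (n + 1) * pderiv (n + 1) 1 φ x (u x)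
                - binom p (n + 2) * iteratedDeriv (n + 2) (fun y => ξ (y, u y)) x)
                * RL 0 (p - (n + 1)) u x)) ∧
    -- the convergence assumptions above hold automatically close to `a`
    (AnalyticAt ℝ u a →
      ∀ᶠ x in 𝓝[>] a,
        TaylorReaches a x u ∧
        TaylorReaches a x (fun y => ξ (y, u y)) ∧
        TaylorReaches a x (fun y => φ (y, u y)) ∧
        TaylorReaches a x (fun y => φ (y, u x)) ∧
        TaylorReaches a x (fun y => deriv (fun w => φ (y, w)) (u x))) := by
  refine ⟨fun x hx hu' hξ' hφ' => ?_, fun hua => ?_⟩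
  · have hax : a < x := hx.1
    have hxM : (x, u x) ∈ M := hgraph x ⟨hx.1.le, hx.2⟩
    have haM : (a, u a) ∈ M := hgraph a ⟨le_rfl, hab⟩
    have hux := hu x hx
    have hRL := hasSum_RL hax p hu'
    have hRLφ := hasSum_RL hax p hφ'
    have hD : ∀ k : ℕ, (totalDeriv^[k] (onJet φ)) (jetOf u x) =
        iteratedDeriv k (fun y => φ (y, u y)) x := totalDeriv_iterate_onJet hux (hφ _ hxM)
    obtain ⟨hdef, hsum, hpro⟩ :=
      prolong_rlJet (p := p) hax (hξ _ hxM) (hφ _ hxM) (hξa _ haM) hu' hξ' hφ'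
    refine ⟨⟨hRL, hRL.tsum_eq⟩, ⟨?_, ?_⟩, ⟨hdef, hsum, hpro⟩, ?_⟩
    · simpa only [hD] using hRLφ.summable
    · simp only [fracTotalDeriv, hD]
      exact hRLφ.tsum_eq
    · rintro rfl hp hφ0 hφ1
      obtain ⟨hmu, hs1, heq⟩ := RL_graph_eq (p := p) hax (hφ _ hxM) hu' hφ' hφ0 hφ1
      have hs2 := (summable_nat_add_iff 1).2 hsum
      have e : ∀ n : ℕ, binom p (n + 1 + 1) *
            iteratedDeriv (n + 1 + 1) (fun y => ξ (y, u y)) x *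
            RL 0 (p - ((n + 1 : ℕ) : ℝ)) u x =
          binom p (n + 2) * iteratedDeriv (n + 2) (fun y => ξ (y, u y)) x *
            RL 0 (p - (n + 1)) u x := fun n => by
        push_cast
        rfl
      simp only [e] at hs2
      have hdist : ∀ n : ℕ, (binom p (n + 1) * pderiv (n + 1) 1 φ x (u x)
            - binom p (n + 2) * iteratedDeriv (n + 2) (fun y => ξ (y, u y)) x)
            * RL 0 (p - (n + 1)) u x =
          binom p (n + 1) * pderiv (n + 1) 1 φ x (u x) * RL 0 (p - (n + 1)) u x -
            binom p (n + 2) * iteratedDeriv (n + 2) (fun y => ξ (y, u y)) x *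
              RL 0 (p - (n + 1)) u x := fun n => sub_mul _ _ _
      refine ⟨hRLφ.congr_fun fun n => sum_sum_sum_oslerTerm p hux (hφ _ hxM) n, hmu, hs1, heq,
        ?_, ?_⟩
      · simp only [hdist]
        exact hs1.sub hs2
      · simp only [hdist]
        rw [hs1.tsum_sub hs2, hpro, heq, hsum.tsum_eq_zero_add]
        simp only [e]
        simp only [zero_add, binom_one, iteratedDeriv_one, Nat.cast_zero, sub_zero]
        ring
  · have haM : (a, u a) ∈ M := hgraph a ⟨le_rfl, hab⟩
    have hφa := hφ _ haM
    exact (eventually_taylorReaches hua).and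
      ((eventually_taylorReaches ((hξ _ haM).graph hua)).and
        ((eventually_taylorReaches (hφa.graph hua)).and
          ((eventually_taylorReaches_slice hφa hua.continuousAt).and
            (eventually_taylorReaches_slice hφa.sliceDu hua.continuousAt))))
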